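/- Let $\alpha_1,\alpha_2,\alpha_3,\beta_1,\beta_2,\beta_3\in\mathbb{C}$ be roots of unity such that $\alpha_1\alpha_2\alpha_3=\beta_1\beta_2\beta_3=1$ and $\sum_{i=1}^3(\alpha_i+\bar\alpha_i)=\sum_{i=1}^3(\beta_i+\bar\beta_i)$. Let $\mathcal{A}=\{\alpha_1,\alpha_2,\alpha_3,\bar\alpha_1,\bar\alpha_2,\bar\alpha_3\}$ and $\mathcal{B}=\{\beta_1,\beta_2,\beta_3,\bar\beta_1,\bar\beta_2,\bar\beta_3\}$, as multisets. Then at least one of the following holds, where in each case $\omega,\iota,\varphi,\sigma,\mu,\nu$ denote suitable roots of unity in $\mathbb{C}$ of exact orders $3,4,5,7,8,16$ respectively, the same ones being used in $\mathcal{A}$ and in $\mathcal{B}$ unless stated otherwise. 1. $\mathcal{A}=\mathcal{B}$. 2. $\mathcal{A}=\{\alpha,-\bar\alpha,-1,\bar\alpha,-\alpha,-1\}$ and $\mathcal{B}=\{\beta,-\bar\beta,-1,\bar\beta,-\beta,-1\}$ for some roots of unity $\alpha,\beta$. 3. After possibly switching $\mathcal{A}$ and $\mathcal{B}$, one of the following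 holds: (a) $\mathcal{A}=\{\mu,-\mu,-\bar\mu^2,\bar\mu,-\bar\mu,-\mu^2\}$ and $\mathcal{B}=\{\omega,\omega^2,1,\omega^2,\omega,1\}$; (b) $\mathcal{A}=\{\varphi,\varphi^2,\bar\varphi^3,\bar\varphi,\bar\varphi^2,\varphi^3\}$ and $\mathcal{B}=\{\omega,-\omega\varphi^2,-\omega\bar\varphi^2,\omega^2,-\omega^2\bar\varphi^2,-\omega^2\varphi^2\}$; (c) $\mathcal{A}=\{\omega,\sigma^3\omega,\bar\sigma^3\omega,\omega^2,\bar\sigma^3\omega^2,\sigma^3\omega^2\}$ and $\mathcal{B}=\{-\sigma\omega,-\sigma\omega^2,\bar\sigma^2,-\bar\sigma\omega^2,-\bar\sigma\omega,\sigma^2\}$; (d) $\mathcal{A}=\{\nu,-\nu,-\bar\nu^2,\bar\nu,-\bar\nu,-\nu^2\}$ and $\mathcal{B}=\{\omega\nu^2,\omega^2\nu^2,\bar\nu^4,\omega^2\bar\nu^2,\omega\bar\nu^2,\nu^4\}$; (e) $\mathcal{A}=\{\omega,\omega\varphi^2,\omega\bar\varphi^2,\omega^2,\omega^2\bar\varphi^2,\omega^2\varphi^2\}$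 and $\mathcal{B}=\{\varphi,\iota\varphi^2,-\iota\bar\varphi^3,\bar\varphi,-\iota\bar\varphi^2,\iota\varphi^3\}$; (f) both $\mathcal{A}$ and $\mathcal{B}$ are among the multisets - (i) $\{\sigma,\sigma^2,\bar\sigma^3,\bar\sigma,\bar\sigma^2,\sigma^3\}$, - (ii) $\{\iota\omega,-\iota\omega,\omega,-\iota\omega^2,\iota\omega^2,\omega^2\}$, - (iii) $\{-\omega\varphi,-\omega^2\varphi,\bar\varphi^2,-\omega^2\bar\varphi,-\omega\bar\varphi,\varphi^2\}$, where, if both $\mathcal{A}$ and $\mathcal{B}$ are of the form (iii), different primitive fifth roots of unity $\varphi$ may be used in $\mathcal{A}$ and in $\mathcal{B}$. -/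

import Mathlib

open scoped ComplexConjugate

/-- The multiset `{γ₁, γ₂, γ₃, γ̄₁, γ̄₂, γ̄₃}` attached to a triple of complex numbers. -/
noncomputable def conjMultiset (γ : Fin 3 → ℂ) : Multiset ℂ :=
  {γ 0, γ 1, γ 2, conj (γ 0), conj (γ 1), conj (γ 2)}

/-- The multiset `{α, -ᾱ, -1, ᾱ, -α, -1}`. -/
noncomputable def negOneMultiset (α : ℂ) : Multiset ℂ :=
  {α, -conj α, -1, conj α, -α, -1}

/-- `{σ, σ², σ̄³, σ̄, σ̄², σ³}`, used with `σ` of order 7. -/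
noncomputable def sevenMultiset (σ : ℂ) : Multiset ℂ :=
  {σ, σ ^ 2, conj σ ^ 3, conj σ, conj σ ^ 2, σ ^ 3}

/-- `{ιω, -ιω, ω, -ιω², ιω², ω²}`, used with `ι` of order 4 and `ω` of order 3. -/
noncomputable def fourThreeMultiset (ι ω : ℂ) : Multiset ℂ :=
  {ι * ω, -(ι * ω), ω, -(ι * ω ^ 2), ι * ω ^ 2, ω ^ 2}

/-- `{-ωφ, -ω²φ, φ̄², -ω²φ̄, -ωφ̄, φ²}`, used with `ω` of order 3 and `φ` of order 5. -/
noncomputable def threeFiveMultiset (ω φ : ℂ) : Multiset ℂ :=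
  {-(ω * φ), -(ω ^ 2 * φ), conj φ ^ 2, -(ω ^ 2 * conj φ), -(ω * conj φ), φ ^ 2}

/-- The exceptional (ordered) pairs `(𝒜, ℬ)` of multisets. -/
def ExceptionalPair (A B : Multiset ℂ) : Prop :=
  -- (a)
  (∃ μ ω : ℂ, IsPrimitiveRoot μ 8 ∧ IsPrimitiveRoot ω 3 ∧
    A = {μ, -μ, -(conj μ ^ 2), conj μ, -conj μ, -(μ ^ 2)} ∧
    B = {ω, ω ^ 2, 1, ω ^ 2, ω, 1}) ∨
  -- (b)
  (∃ φ ω : ℂ, IsPrimitiveRoot φ 5 ∧ IsPrimitiveRoot ω 3 ∧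
    A = {φ, φ ^ 2, conj φ ^ 3, conj φ, conj φ ^ 2, φ ^ 3} ∧
    B = {ω, -(ω * φ ^ 2), -(ω * conj φ ^ 2),
      ω ^ 2, -(ω ^ 2 * conj φ ^ 2), -(ω ^ 2 * φ ^ 2)}) ∨
  -- (c)
  (∃ σ ω : ℂ, IsPrimitiveRoot σ 7 ∧ IsPrimitiveRoot ω 3 ∧
    A = {ω, σ ^ 3 * ω, conj σ ^ 3 * ω, ω ^ 2, conj σ ^ 3 * ω ^ 2, σ ^ 3 * ω ^ 2} ∧
    B = {-(σ * ω), -(σ * ω ^ 2), conj σ ^ 2,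
      -(conj σ * ω ^ 2), -(conj σ * ω), σ ^ 2}) ∨
  -- (d)
  (∃ ν ω : ℂ, IsPrimitiveRoot ν 16 ∧ IsPrimitiveRoot ω 3 ∧
    A = {ν, -ν, -(conj ν ^ 2), conj ν, -conj ν, -(ν ^ 2)} ∧
    B = {ω * ν ^ 2, ω ^ 2 * ν ^ 2, conj ν ^ 4,
      ω ^ 2 * conj ν ^ 2, ω * conj ν ^ 2, ν ^ 4}) ∨
  -- (e)
  (∃ φ ω ι : ℂ, IsPrimitiveRoot φ 5 ∧ IsPrimitiveRoot ω 3 ∧ IsPrimitiveRoot ι 4 ∧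
    A = {ω, ω * φ ^ 2, ω * conj φ ^ 2, ω ^ 2, ω ^ 2 * conj φ ^ 2, ω ^ 2 * φ ^ 2} ∧
    B = {φ, ι * φ ^ 2, -(ι * conj φ ^ 3), conj φ, -(ι * conj φ ^ 2), ι * φ ^ 3}) ∨
  -- (f): the same `ω, ι, φ, σ` serve for both multisets, except that two multisets of the
  -- last type may use different primitive fifth roots of unity
  (∃ ω ι φ σ : ℂ, IsPrimitiveRoot ω 3 ∧ IsPrimitiveRoot ι 4 ∧ IsPrimitiveRoot φ 5 ∧
    IsPrimitiveRoot σ 7 ∧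
    (((A = sevenMultiset σ ∨ A = fourThreeMultiset ι ω ∨ A = threeFiveMultiset ω φ) ∧
      (B = sevenMultiset σ ∨ B = fourThreeMultiset ι ω ∨ B = threeFiveMultiset ω φ)) ∨
     (∃ φ' : ℂ, IsPrimitiveRoot φ' 5 ∧ φ' ≠ φ ∧
      A = threeFiveMultiset ω φ ∧ B = threeFiveMultiset ω φ')))

/-! Write each multiset as `{x, y, z, x⁻¹, y⁻¹, z⁻¹}` with `xyz = 1`, all entries being `N`-th roots
of unity for a common `N`. Since the inverses are the pairwise products, its sum is `(1+x)(1+y)(1+z)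
- 2`. Hence `-1` occurs exactly when the sum is `-2`, which is the one-parameter family; otherwise
two multisets with equal sums and one common element are equal (`IsTriple.eq_of_common`). It remains
to treat disjoint multisets avoiding `-1`, by strong induction on `N`.

For a prime `p` with `N = p * M`, sort the elements `t` by their class `t ^ M`. Averaging over the
Galois conjugations `t ↦ t ^ (1 + M * k)` shows that the class sums of `A` and `B` differ by `C`
times the `p`-th root of unity in that class, with `C = 0` if `p ∣ M` (`exists_classSum_sub_eq`).

If `C = 0`, a comparison of the few possible distributions over classes forces every element into
the trivial class, so `N` drops to `M`. This works for `p ≥ 7`, and for `p = 5, 3, 2` when `25`,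
`9`, `32` respectively divides `N`. If `C ≠ 0`, every class is occupied by `A` or `B`, so `p ≤ 9`.
For `p = 7` this leaves family (c), or the primitive seventh roots of unity against a triple of
trace `-1` whose order divides `240` (`ClassShift.seven`).

The remaining case is `N ∣ 240`. A relation between 240th roots of unity survives reduction to a
prime field containing such roots, so a finite computation there (`bucketCheck_encodedTriples`)
bounds the possible coincidences. Every coincidence it leaves belongs to a listed family. -/

/-! ### Galois conjugation of relations between roots of unity. -/

open Polynomial in
theorem aeval_sum_map_X_pow {R : Type*} [CommRing R] (z : R) (E : Multiset ℕ) :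
    aeval z (E.map (fun n => (X : ℤ[X]) ^ n)).sum = (E.map (z ^ ·)).sum := by
  rw [map_multiset_sum, Multiset.map_map]
  simp

-- The difference of the two sides, as an integer polynomial in `ζ`, is divisible by the minimal
-- polynomial of `ζ`, which is cyclotomic. The ring `R` is arbitrary because this serves twice: for
-- Galois conjugates in `ℂ`, and for reduction to a prime field.
open Polynomial in
theorem sum_map_pow_eq_of_isRoot_cyclotomic {R : Type*} [CommRing R] {N : ℕ} (hN : 0 < N) {ζ : ℂ}
    (hζ : IsPrimitiveRoot ζ N) {E F : Multiset ℕ}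
    (h : (E.map (ζ ^ ·)).sum = (F.map (ζ ^ ·)).sum) {g : R}
    (hg : (cyclotomic N R).IsRoot g) :
    (E.map (g ^ ·)).sum = (F.map (g ^ ·)).sum := by
  have hd : cyclotomic N ℤ ∣ (E.map (fun n => (X : ℤ[X]) ^ n)).sum
      - (F.map (fun n => (X : ℤ[X]) ^ n)).sum := by
    rw [cyclotomic_eq_minpoly hζ hN]
    refine minpoly.isIntegrallyClosed_dvd (hζ.isIntegral hN) ?_
    rw [map_sub, aeval_sum_map_X_pow, aeval_sum_map_X_pow, h, sub_self]
  obtain ⟨q, hq⟩ := hd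
  have h2 := congrArg (aeval g) hq
  rw [map_sub, aeval_sum_map_X_pow, aeval_sum_map_X_pow, map_mul] at h2
  have h3 : aeval g (cyclotomic N ℤ) = 0 := by
    rw [aeval_def, ← eval_map, algebraMap_int_eq, map_cyclotomic]
    exact hg
  rw [h3, zero_mul] at h2
  exact sub_eq_zero.mp h2

theorem IsPrimitiveRoot.exists_multiset_eq_map_pow {N : ℕ} (hN : 0 < N) {ζ : ℂ}
    (hζ : IsPrimitiveRoot ζ N) (A : Multiset ℂ) (hA : ∀ x ∈ A, x ^ N = 1) :
    ∃ E : Multiset ℕ, A = E.map (ζ ^ ·) := by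
  induction A using Multiset.induction_on with
  | empty => exact ⟨0, by simp⟩
  | cons a A ih =>
    obtain ⟨E, rfl⟩ := ih fun x hx => hA x (Multiset.mem_cons_of_mem hx)
    have : NeZero N := ⟨hN.ne'⟩
    obtain ⟨i, -, hi⟩ := hζ.eq_pow_of_pow_eq_one (hA a (Multiset.mem_cons_self _ _))
    exact ⟨i ::ₘ E, by simp [hi]⟩

theorem sum_map_pow_eq_of_coprime {N : ℕ} (hN : 0 < N) {A B : Multiset ℂ}
    (hA : ∀ x ∈ A, x ^ N = 1) (hB : ∀ x ∈ B, x ^ N = 1) (h : A.sum = B.sum) {k : ℕ}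
    (hk : k.Coprime N) : (A.map (· ^ k)).sum = (B.map (· ^ k)).sum := by
  have hζ := Complex.isPrimitiveRoot_exp N hN.ne'
  obtain ⟨E, rfl⟩ := hζ.exists_multiset_eq_map_pow hN A hA
  obtain ⟨F, rfl⟩ := hζ.exists_multiset_eq_map_pow hN B hB
  have := sum_map_pow_eq_of_isRoot_cyclotomic hN hζ h
    ((hζ.pow_of_coprime k hk).isRoot_cyclotomic hN)
  simp only [Multiset.map_map, Function.comp_def, ← pow_mul] at this ⊢
  simpa only [mul_comm] using this

/-! ### Splitting a relation into classes modulo the `M`-th roots of unity. -/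

/-- The sum of the elements `x` of `A` with `x ^ M = ε`. -/
noncomputable def classSum (M : ℕ) (ε : ℂ) (A : Multiset ℂ) : ℂ :=
  (A.map fun x => if x ^ M = ε then x else 0).sum

theorem sum_pow_mul_inv_pow {p : ℕ} (hp : 0 < p) {y ε : ℂ} (hy : y ^ p = 1) (hε : ε ^ p = 1) :
    ∑ t ∈ Finset.range p, ε⁻¹ ^ t * y ^ t = if y = ε then (p : ℂ) else 0 := by
  have hε0 : ε ≠ 0 := by rintro rfl; simp [hp.ne'] at hε
  split_ifs with h
  · subst h
    simp [hε0]
  · simp_rw [← mul_pow]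
    have h1 : ε⁻¹ * y ≠ 1 := by
      intro h1
      exact h (by field_simp at h1; exact h1)
    rw [geom_sum_eq h1, mul_pow, inv_pow, hε, hy]
    simp

/-- Finite Fourier inversion on the `p`-th roots of unity `x ^ M`. The factor `x` is absorbed into
the exponent `1 + M * t`, so that each term is the sum of `A` after a power map fixing the `M`-th
roots of unity. -/
theorem classSum_eq_fourier {p M : ℕ} (hp : 0 < p) {ε : ℂ} (hε : ε ^ p = 1) (A : Multiset ℂ)
    (hA : ∀ x ∈ A, x ^ (p * M) = 1) :
    (p : ℂ) * classSum M ε A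
      = ∑ t ∈ Finset.range p, ε⁻¹ ^ t * (A.map fun x => x ^ (1 + M * t)).sum := by
  induction A using Multiset.induction_on with
  | empty => simp [classSum]
  | cons a A ih =>
    have ih := ih fun x hx => hA x (Multiset.mem_cons_of_mem hx)
    have ha : (a ^ M) ^ p = 1 := by
      rw [← pow_mul, mul_comm]; exact hA a (Multiset.mem_cons_self _ _)
    have := sum_pow_mul_inv_pow hp ha hε
    simp only [classSum, Multiset.map_cons, Multiset.sum_cons, mul_add, Finset.sum_add_distrib]
      at ih ⊢
    rw [ih]
    congr 1
    have h2 : ∀ t, ε⁻¹ ^ t * a ^ (1 + M * t) = a * (ε⁻¹ ^ t * (a ^ M) ^ t) := by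
      intro t; rw [pow_add, pow_mul]; ring
    simp_rw [h2, ← Finset.mul_sum, this]
    split_ifs <;> ring

/-- A relation between roots of unity of order dividing `p * M` splits into relations between
the classes modulo the roots of unity of order dividing `M`. -/
theorem exists_classSum_sub_eq {p M : ℕ} (hp : p.Prime) (hM : 0 < M) {A B : Multiset ℂ}
    (hA : ∀ x ∈ A, x ^ (p * M) = 1) (hB : ∀ x ∈ B, x ^ (p * M) = 1) (h : A.sum = B.sum) :
    ∃ (C : ℂ) (s : ℕ), (p ∣ M → C = 0) ∧ (p ∣ M ∨ p ∣ 1 + M * s) ∧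
      ∀ ε : ℂ, ε ^ p = 1 → classSum M ε A - classSum M ε B = C * ε⁻¹ ^ s := by
  have hp0 : (p : ℂ) ≠ 0 := by exact_mod_cast hp.ne_zero
  -- The exponent `1 + M * t` is always prime to `M`, so it defines a Galois conjugation unless `p`
  -- divides it.
  have gal : ∀ t, ¬ p ∣ 1 + M * t → (A.map fun x => x ^ (1 + M * t)).sum
      - (B.map fun x => x ^ (1 + M * t)).sum = 0 := by
    intro t ht
    rw [sub_eq_zero]
    refine sum_map_pow_eq_of_coprime (Nat.mul_pos hp.pos hM) hA hB h ?_
    refine Nat.Coprime.mul_right ?_ ?_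
    · exact ((Nat.Prime.coprime_iff_not_dvd hp).mpr ht).symm
    · simp
  have main : ∀ ε : ℂ, ε ^ p = 1 → (p : ℂ) * (classSum M ε A - classSum M ε B) =
      ∑ t ∈ Finset.range p, ε⁻¹ ^ t * ((A.map fun x => x ^ (1 + M * t)).sum
      - (B.map fun x => x ^ (1 + M * t)).sum) := by
    intro ε hε
    rw [mul_sub, classSum_eq_fourier hp.pos hε A hA, classSum_eq_fourier hp.pos hε B hB,
      ← Finset.sum_sub_distrib]
    simp_rw [mul_sub]
  by_cases hpM : p ∣ M
  · refine ⟨0, 0, fun _ => rfl, Or.inl hpM, fun ε hε => ?_⟩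
    have := main ε hε
    rw [Finset.sum_eq_zero] at this
    · simpa [hp0] using this
    · intro t _
      rw [gal t, mul_zero]
      intro h3
      have : p ∣ 1 := (Nat.dvd_add_left (hpM.mul_right t)).mp h3
      exact hp.one_lt.ne' (Nat.dvd_one.mp this)
  · have hcop : Nat.Coprime M p := ((Nat.Prime.coprime_iff_not_dvd hp).mpr hpM).symm
    have : Fact p.Prime := ⟨hp⟩
    have hM0 : (M : ZMod p) ≠ 0 := by rwa [Ne, ZMod.natCast_eq_zero_iff]
    -- When `p ∤ M` exactly one Fourier term escapes the Galois argument. As `M * s ≡ -1` modulo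
    -- `p`, the number `ε⁻¹ ^ s` is the `p`-th root of unity whose `M`-th power is `ε`.
    have hs : ∃ s < p, ∀ t < p, p ∣ 1 + M * t ↔ t = s := by
      have hval : ∀ t : ℕ, p ∣ 1 + M * t ↔ (t : ZMod p) = -(M : ZMod p)⁻¹ := by
        intro t
        rw [← ZMod.natCast_eq_zero_iff]
        push_cast
        constructor
        · intro h
          field_simp
          linear_combination h
        · intro h
          rw [h]; field_simp; ring
      refine ⟨(-(M : ZMod p)⁻¹).val, ZMod.val_lt _, fun t ht => ?_⟩
      rw [hval]
      constructor
      · intro h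
        rw [← h, ZMod.val_natCast_of_lt ht]
      · rintro rfl
        simp
    obtain ⟨s, hsp, hs⟩ := hs
    refine ⟨((A.map fun x => x ^ (1 + M * s)).sum
      - (B.map fun x => x ^ (1 + M * s)).sum) / p, s, fun h => absurd h hpM,
      Or.inr ((hs s hsp).mpr rfl), fun ε hε => ?_⟩
    have := main ε hε
    rw [Finset.sum_eq_single s] at this
    · field_simp
      linear_combination this
    · intro t ht hts
      rw [gal t, mul_zero]
      rw [hs t (Finset.mem_range.mp ht)]
      exact hts
    · intro h; exact absurd (Finset.mem_range.mpr hsp) h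

/-! ### Inverse-closed triples with product one. -/

/-- The multiset `{x, y, z, x⁻¹, y⁻¹, z⁻¹}`. -/
noncomputable def invMultiset (x y z : ℂ) : Multiset ℂ := {x, y, z, x⁻¹, y⁻¹, z⁻¹}

theorem invMultiset_swap (x y z : ℂ) : invMultiset x y z = invMultiset y x z := by
  simp only [invMultiset, Multiset.insert_eq_cons, ← Multiset.singleton_add]
  abel

theorem invMultiset_rotate (x y z : ℂ) : invMultiset x y z = invMultiset y z x := by
  simp only [invMultiset, Multiset.insert_eq_cons, ← Multiset.singleton_add]
  abel

theorem invMultiset_inv (x y z : ℂ) : invMultiset x y z = invMultiset x⁻¹ y⁻¹ z⁻¹ := by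
  simp only [invMultiset, Multiset.insert_eq_cons, ← Multiset.singleton_add, inv_inv]
  abel

theorem mem_invMultiset {x y z t : ℂ} :
    t ∈ invMultiset x y z ↔ t = x ∨ t = y ∨ t = z ∨ t = x⁻¹ ∨ t = y⁻¹ ∨ t = z⁻¹ := by
  simp [invMultiset]

theorem sum_invMultiset (x y z : ℂ) :
    (invMultiset x y z).sum = x + y + z + x⁻¹ + y⁻¹ + z⁻¹ := by
  simp [invMultiset]; ring

theorem classSum_invMultiset (M : ℕ) (ε x y z : ℂ) :
    classSum M ε (invMultiset x y z) =
      (if x ^ M = ε then x else 0) + (if y ^ M = ε then y else 0) + (if z ^ M = ε then z else 0)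
      + (if (x ^ M)⁻¹ = ε then x⁻¹ else 0) + (if (y ^ M)⁻¹ = ε then y⁻¹ else 0)
      + (if (z ^ M)⁻¹ = ε then z⁻¹ else 0) := by
  simp [invMultiset, classSum]; ring

/-- `A` is the inverse-closed multiset of three `N`-th roots of unity with product one. -/
structure IsTriple (N : ℕ) (A : Multiset ℂ) (x y z : ℂ) : Prop where
  hx : x ^ N = 1
  hy : y ^ N = 1
  hz : z ^ N = 1
  prod : x * y * z = 1
  eq : A = invMultiset x y z

namespace IsTriple

variable {N : ℕ} {A B : Multiset ℂ} {x y z u v w : ℂ}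

theorem x_ne_zero (h : IsTriple N A x y z) : x ≠ 0 := by
  rintro rfl; simpa using h.prod

theorem y_ne_zero (h : IsTriple N A x y z) : y ≠ 0 := by
  rintro rfl; simpa using h.prod

theorem z_ne_zero (h : IsTriple N A x y z) : z ≠ 0 := by
  rintro rfl; simpa using h.prod

theorem swap (h : IsTriple N A x y z) : IsTriple N A y x z :=
  ⟨h.hy, h.hx, h.hz, by rw [← h.prod]; ring, by rw [h.eq, invMultiset_swap]⟩

theorem rotate (h : IsTriple N A x y z) : IsTriple N A y z x :=
  ⟨h.hy, h.hz, h.hx, by rw [← h.prod]; ring, by rw [h.eq, invMultiset_rotate]⟩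

theorem inv (h : IsTriple N A x y z) : IsTriple N A x⁻¹ y⁻¹ z⁻¹ :=
  ⟨by simp [h.hx], by simp [h.hy], by simp [h.hz],
    by rw [← mul_inv, ← mul_inv, h.prod, inv_one], by rw [h.eq, invMultiset_inv]⟩

theorem x_mem (h : IsTriple N A x y z) : x ∈ A := by rw [h.eq, mem_invMultiset]; simp
theorem y_mem (h : IsTriple N A x y z) : y ∈ A := by rw [h.eq, mem_invMultiset]; simp
theorem z_mem (h : IsTriple N A x y z) : z ∈ A := by rw [h.eq, mem_invMultiset]; simp
theorem x_inv_mem (h : IsTriple N A x y z) : x⁻¹ ∈ A := by rw [h.eq, mem_invMultiset]; simp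
theorem y_inv_mem (h : IsTriple N A x y z) : y⁻¹ ∈ A := by rw [h.eq, mem_invMultiset]; simp
theorem z_inv_mem (h : IsTriple N A x y z) : z⁻¹ ∈ A := by rw [h.eq, mem_invMultiset]; simp

theorem forall_mem (h : IsTriple N A x y z) {P : ℂ → Prop} (hx : P x) (hy : P y) (hz : P z)
    (hi : ∀ t, P t → P t⁻¹) : ∀ t ∈ A, P t := by
  intro t ht
  rw [h.eq, mem_invMultiset] at ht
  rcases ht with rfl | rfl | rfl | rfl | rfl | rfl
  exacts [hx, hy, hz, hi _ hx, hi _ hy, hi _ hz]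

theorem pow_eq_one (h : IsTriple N A x y z) : ∀ t ∈ A, t ^ N = 1 :=
  h.forall_mem h.hx h.hy h.hz fun t ht => by rw [inv_pow, ht, inv_one]

theorem restrict (h : IsTriple N A x y z) {M : ℕ} (hM : ∀ t ∈ A, t ^ M = 1) :
    IsTriple M A x y z :=
  ⟨hM _ h.x_mem, hM _ h.y_mem, hM _ h.z_mem, h.prod, h.eq⟩

theorem exists_of_mem (h : IsTriple N A x y z) {t : ℂ} (ht : t ∈ A) :
    ∃ y' z', IsTriple N A t y' z' := by
  have h' := ht
  rw [h.eq, mem_invMultiset] at h'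
  rcases h' with rfl | rfl | rfl | rfl | rfl | rfl
  exacts [⟨_, _, h⟩, ⟨_, _, h.rotate⟩, ⟨_, _, h.rotate.rotate⟩, ⟨_, _, h.inv⟩,
    ⟨_, _, h.inv.rotate⟩, ⟨_, _, h.inv.rotate.rotate⟩]

/-- As `xyz = 1`, the inverses are the pairwise products, so the sum is `e₁ + e₂` while
`(1+x)(1+y)(1+z) = 1 + e₁ + e₂ + 1`. -/
theorem sum_eq (h : IsTriple N A x y z) : A.sum = (1 + x) * (1 + y) * (1 + z) - 2 := by
  have hx := h.x_ne_zero
  have hy := h.y_ne_zero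
  have hz := h.z_ne_zero
  have hp := h.prod
  rw [h.eq, sum_invMultiset]
  have h1 : x⁻¹ = y * z := by field_simp; linear_combination -hp
  have h2 : y⁻¹ = x * z := by field_simp; linear_combination -hp
  have h3 : z⁻¹ = x * y := by field_simp; linear_combination -hp
  rw [h1, h2, h3]
  linear_combination -hp

theorem neg_one_mem_iff (h : IsTriple N A x y z) : -1 ∈ A ↔ A.sum = -2 := by
  constructor
  · intro hm
    obtain ⟨y', z', h'⟩ := h.exists_of_mem hm
    rw [h'.sum_eq]; ring
  · intro hs
    rw [h.sum_eq] at hs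
    have : (1 + x) * (1 + y) * (1 + z) = 0 := by linear_combination hs
    rcases mul_eq_zero.mp this with h1 | h1
    · rcases mul_eq_zero.mp h1 with h1 | h1
      · have : x = -1 := by linear_combination h1
        exact this ▸ h.x_mem
      · have : y = -1 := by linear_combination h1
        exact this ▸ h.y_mem
    · have : z = -1 := by linear_combination h1
      exact this ▸ h.z_mem

theorem neg_one_mem_of_mul_eq (h : IsTriple N A x y z) (hyz : y * z = -1) : -1 ∈ A := by
  have : x = -1 := by linear_combination (-1 : ℂ) * h.prod + x * hyz
  exact this ▸ h.x_mem

/-- Two triples with equal sums and a common element other than `-1` coincide. -/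
theorem eq_of_common (hA : IsTriple N A x y z) (hB : IsTriple N B u v w) (h : A.sum = B.sum)
    (hn : -1 ∉ A) {t : ℂ} (htA : t ∈ A) (htB : t ∈ B) : A = B := by
  obtain ⟨y, z, hA⟩ := hA.exists_of_mem htA
  obtain ⟨v, w, hB⟩ := hB.exists_of_mem htB
  have ht : 1 + t ≠ 0 := by
    intro h0
    exact hn ((show t = -1 by linear_combination h0) ▸ htA)
  have ht0 := hA.x_ne_zero
  have hm : y * z = v * w := by
    apply mul_left_cancel₀ ht0
    linear_combination hA.prod - hB.prod
  -- Cancelling `1 + t ≠ 0` makes `{y, z}` and `{v, w}` the roots of the same quadratic.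
  have hs : y + z = v + w := by
    rw [hA.sum_eq, hB.sum_eq] at h
    apply mul_left_cancel₀ ht
    linear_combination h - (1 + t) * hm
  have : (y - v) * (y - w) = 0 := by linear_combination -hm + y * hs
  rcases mul_eq_zero.mp this with h1 | h1
  · have hy : y = v := by linear_combination h1
    have hz : z = w := by linear_combination hs - hy
    rw [hA.eq, hB.eq, hy, hz]
  · have hy : y = w := by linear_combination h1
    have hz : z = v := by linear_combination hs - hy
    rw [hA.eq, hB.rotate.swap.rotate.rotate.eq, hy, hz]

end IsTriple

/-! ### Types of triples according to the classes of their members. -/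

/-- The class `x ^ M` is trivial for one member of the triple. -/
structure IsTypeL (p M : ℕ) (A : Multiset ℂ) (x y z a : ℂ) : Prop
    extends IsTriple (p * M) A x y z where
  prim : IsPrimitiveRoot a p
  cx : x ^ M = 1
  cy : y ^ M = a
  cz : z ^ M = a⁻¹

/-- Two members of the triple have the same nontrivial class. -/
structure IsTypeD (p M : ℕ) (A : Multiset ℂ) (x y z a : ℂ) : Prop
    extends IsTriple (p * M) A x y z where
  prim : IsPrimitiveRoot a p
  cx : x ^ M = a
  cy : y ^ M = a
  cz : z ^ M = (a ^ 2)⁻¹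

/-- The three classes are nontrivial and distinct. -/
structure IsTypeG (p M : ℕ) (A : Multiset ℂ) (x y z : ℂ) : Prop
    extends IsTriple (p * M) A x y z where
  cx : x ^ M ≠ 1
  cy : y ^ M ≠ 1
  cz : z ^ M ≠ 1
  cxy : x ^ M ≠ y ^ M
  cyz : y ^ M ≠ z ^ M
  czx : z ^ M ≠ x ^ M

theorem isPrimitiveRoot_of_pow_prime {p : ℕ} (hp : p.Prime) {a : ℂ} (h : a ^ p = 1) (h1 : a ≠ 1) :
    IsPrimitiveRoot a p := by
  have : Fact p.Prime := ⟨hp⟩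
  rw [← orderOf_eq_prime h h1]
  exact IsPrimitiveRoot.orderOf a

/-- The three classes multiply to `1`, so two of them determine the third. Small primes degenerate:
in type D the class of `z` is trivial for `p = 2` and equals `a` for `p = 3`. -/
theorem IsTriple.types {p M : ℕ} (hp : p.Prime) {A : Multiset ℂ} {x y z : ℂ}
    (h : IsTriple (p * M) A x y z) :
    (∀ t ∈ A, t ^ M = 1) ∨ (∃ x y z a, IsTypeL p M A x y z a) ∨
      (∃ x y z a, IsTypeD p M A x y z a) ∨ ∃ x y z, IsTypeG p M A x y z := by
  have prim : ∀ {t : ℂ}, t ^ (p * M) = 1 → t ^ M ≠ 1 → IsPrimitiveRoot (t ^ M) p := by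
    intro t ht h1
    exact isPrimitiveRoot_of_pow_prime hp (by rw [← pow_mul, mul_comm, ht]) h1
  have hL : ∀ {x y z : ℂ}, IsTriple (p * M) A x y z → x ^ M = 1 → y ^ M ≠ 1 →
      ∃ x y z a, IsTypeL p M A x y z a := by
    intro x y z h hx hy
    refine ⟨x, y, z, y ^ M, h, prim h.hy hy, hx, rfl, ?_⟩
    have := congrArg (· ^ M) h.prod
    simp only [mul_pow, hx, one_pow, one_mul] at this
    exact eq_inv_of_mul_eq_one_right this
  have hD : ∀ {x y z : ℂ}, IsTriple (p * M) A x y z → x ^ M ≠ 1 → x ^ M = y ^ M →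
      ∃ x y z a, IsTypeD p M A x y z a := by
    intro x y z h hx hy
    refine ⟨x, y, z, y ^ M, h, prim h.hy (hy ▸ hx), hy, rfl, ?_⟩
    have := congrArg (· ^ M) h.prod
    simp only [mul_pow, hy, one_pow, ← sq] at this
    exact eq_inv_of_mul_eq_one_right this
  by_cases h1 : x ^ M = 1
  · by_cases h2 : y ^ M = 1
    · left
      refine h.forall_mem h1 h2 ?_ fun t ht => by rw [inv_pow, ht, inv_one]
      have := congrArg (· ^ M) h.prod
      simpa only [mul_pow, h1, h2, one_pow, one_mul] using this
    · exact Or.inr (Or.inl (hL h h1 h2))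
  by_cases h2 : y ^ M = 1
  · exact Or.inr (Or.inl (hL h.swap h2 h1))
  by_cases h3 : z ^ M = 1
  · exact Or.inr (Or.inl (hL h.rotate.rotate h3 h1))
  by_cases h4 : x ^ M = y ^ M
  · exact Or.inr (Or.inr (Or.inl (hD h h1 h4)))
  by_cases h5 : y ^ M = z ^ M
  · exact Or.inr (Or.inr (Or.inl (hD h.rotate h2 h5)))
  by_cases h6 : z ^ M = x ^ M
  · exact Or.inr (Or.inr (Or.inl (hD h.rotate.rotate h3 h6)))
  exact Or.inr (Or.inr (Or.inr ⟨x, y, z, h, h1, h2, h3, h4, h5, h6⟩))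

theorem classSum_of_trivial {M : ℕ} {A : Multiset ℂ} (h : ∀ t ∈ A, t ^ M = 1) :
    classSum M 1 A = A.sum := by
  unfold classSum
  congr 1
  conv_rhs => rw [← Multiset.map_id A]
  refine Multiset.map_congr rfl fun t ht => ?_
  simp [h t ht]

theorem classSum_eq_zero {M : ℕ} {ε : ℂ} {A : Multiset ℂ} (h : ∀ t ∈ A, t ^ M ≠ ε) :
    classSum M ε A = 0 := by
  unfold classSum
  rw [Multiset.sum_eq_zero]
  intro x hx
  obtain ⟨t, ht, rfl⟩ := Multiset.mem_map.mp hx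
  simp [h t ht]

theorem exists_mem_of_classSum_ne_zero {M : ℕ} {ε : ℂ} {A : Multiset ℂ}
    (h : classSum M ε A ≠ 0) : ∃ t ∈ A, t ^ M = ε := by
  by_contra! h'
  exact h (classSum_eq_zero h')

theorem IsPrimitiveRoot.zpow_eq_zpow_iff {p : ℕ} {a : ℂ} (h : IsPrimitiveRoot a p) (hp : p ≠ 0)
    (i j : ℤ) : a ^ i = a ^ j ↔ (p : ℤ) ∣ i - j := by
  rw [← h.zpow_eq_one_iff_dvd, zpow_sub₀ (h.ne_zero hp), div_eq_one_iff_eq]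
  exact zpow_ne_zero _ (h.ne_zero hp)

theorem Int.not_natCast_dvd_of_lt {p : ℕ} (k : ℕ) (h0 : 0 < k) (h : k < p) : ¬ (p : ℤ) ∣ k := by
  intro hd
  exact absurd (Nat.le_of_dvd h0 (by exact_mod_cast hd)) (by omega)

namespace IsTypeL

variable {p M : ℕ} {A : Multiset ℂ} {x y z a : ℂ}

theorem inv (h : IsTypeL p M A x y z a) : IsTypeL p M A x⁻¹ y⁻¹ z⁻¹ a⁻¹ :=
  ⟨h.toIsTriple.inv, h.prim.inv, by simp [h.cx], by simp [h.cy], by simp [h.cz]⟩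

theorem ne_one (h : IsTypeL p M A x y z a) (hp : 3 ≤ p) : a ≠ 1 :=
  h.prim.ne_one (by omega)

theorem ne_inv (h : IsTypeL p M A x y z a) (hp : 3 ≤ p) : a ≠ a⁻¹ := by
  have := (h.prim.zpow_eq_zpow_iff (by omega) 1 (-1)).not.mpr (by
    simpa using Int.not_natCast_dvd_of_lt 2 (by omega) (by omega : 2 < p))
  simpa using this

theorem classSum_one (h : IsTypeL p M A x y z a) (hp : 3 ≤ p) :
    classSum M 1 A = x + x⁻¹ := by
  rw [h.eq, classSum_invMultiset, h.cx, h.cy, h.cz]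
  simp [h.ne_one hp]

theorem classSum_self (h : IsTypeL p M A x y z a) (hp : 3 ≤ p) :
    classSum M a A = y + z⁻¹ := by
  rw [h.eq, classSum_invMultiset, h.cx, h.cy, h.cz]
  simp [(h.ne_one hp).symm, (h.ne_inv hp).symm]

theorem classSum_inv (h : IsTypeL p M A x y z a) (hp : 3 ≤ p) :
    classSum M a⁻¹ A = z + y⁻¹ := by
  rw [h.inv.classSum_self hp, inv_inv, add_comm]

theorem classSum_other (h : IsTypeL p M A x y z a) {ε : ℂ} (h1 : ε ≠ 1) (h2 : ε ≠ a)
    (h3 : ε ≠ a⁻¹) : classSum M ε A = 0 := by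
  rw [h.eq, classSum_invMultiset, h.cx, h.cy, h.cz]
  simp [h1.symm, h2.symm, h3.symm]

end IsTypeL

namespace IsTypeD

variable {p M : ℕ} {A : Multiset ℂ} {x y z a : ℂ}

theorem inv (h : IsTypeD p M A x y z a) : IsTypeD p M A x⁻¹ y⁻¹ z⁻¹ a⁻¹ :=
  ⟨h.toIsTriple.inv, h.prim.inv, by simp [h.cx], by simp [h.cy], by simp [h.cz]⟩

theorem classSum_one (h : IsTypeD p M A x y z a) (hp : 5 ≤ p) : classSum M 1 A = 0 := by
  have key := h.prim.zpow_eq_zpow_iff (by omega)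
  have d1 : ¬ (p : ℤ) ∣ 1 := Int.not_natCast_dvd_of_lt 1 (by omega) (by omega)
  have d2 : ¬ (p : ℤ) ∣ 2 := Int.not_natCast_dvd_of_lt 2 (by omega) (by omega)
  have k1 : a ≠ 1 := by
    have := key 1 0
    norm_num [d1] at this; exact this
  rw [h.eq, classSum_invMultiset, h.cx, h.cy, h.cz]
  have k2' : a ^ 2 ≠ 1 := by
    have := (key 2 0).not.mpr (by simpa using d2)
    exact_mod_cast this
  simp [k1, k2']

theorem classSum_self (h : IsTypeD p M A x y z a) (hp : 5 ≤ p) :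
    classSum M a A = x + y := by
  have key := h.prim.zpow_eq_zpow_iff (by omega)
  have d1 : ¬ (p : ℤ) ∣ 1 := Int.not_natCast_dvd_of_lt 1 (by omega) (by omega)
  have d2 : ¬ (p : ℤ) ∣ 2 := Int.not_natCast_dvd_of_lt 2 (by omega) (by omega)
  have d3 : ¬ (p : ℤ) ∣ 3 := Int.not_natCast_dvd_of_lt 3 (by omega) (by omega)
  have e1 : a⁻¹ ≠ a := by
    have := key (-1) 1
    norm_num [d2] at this; exact this
  have e2 : a ^ 2 ≠ a := by
    have := key 2 1
    norm_num [d1] at this; exact_mod_cast this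
  have e3 : (a ^ 2)⁻¹ ≠ a := by
    have := key (-2) 1
    norm_num [d3] at this
    exact this
  rw [h.eq, classSum_invMultiset, h.cx, h.cy, h.cz]
  simp [e1, e2, e3]

theorem classSum_sq_inv (h : IsTypeD p M A x y z a) (hp : 5 ≤ p) :
    classSum M (a ^ 2)⁻¹ A = z := by
  have key := h.prim.zpow_eq_zpow_iff (by omega)
  have d1 : ¬ (p : ℤ) ∣ 1 := Int.not_natCast_dvd_of_lt 1 (by omega) (by omega)
  have d3 : ¬ (p : ℤ) ∣ 3 := Int.not_natCast_dvd_of_lt 3 (by omega) (by omega)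
  have d4 : ¬ (p : ℤ) ∣ 4 := Int.not_natCast_dvd_of_lt 4 (by omega) (by omega)
  have e1 : a ≠ (a ^ 2)⁻¹ := by
    have := key 1 (-2)
    norm_num [d3] at this
    exact this
  have e2 : a⁻¹ ≠ (a ^ 2)⁻¹ := by
    have := key (-1) (-2)
    norm_num [d1] at this
    exact inv_injective.ne this
  have e3 : a ^ 2 ≠ (a ^ 2)⁻¹ := by
    have := key 2 (-2)
    norm_num [d4] at this
    exact this
  rw [h.eq, classSum_invMultiset, h.cx, h.cy, h.cz, inv_inv]
  simp only [e1, e2, e3, if_true, if_false]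
  ring

theorem classSum_other (h : IsTypeD p M A x y z a) {ε : ℂ} (h1 : ε ≠ a) (h2 : ε ≠ a⁻¹)
    (h3 : ε ≠ (a ^ 2)⁻¹) (h4 : ε ≠ a ^ 2) : classSum M ε A = 0 := by
  rw [h.eq, classSum_invMultiset, h.cx, h.cy, h.cz, inv_inv]
  simp only [h1.symm, h2.symm, h3.symm, h4.symm, if_false, add_zero]

end IsTypeD

namespace IsTypeG

variable {p M : ℕ} {A : Multiset ℂ} {x y z : ℂ}

theorem swap (h : IsTypeG p M A x y z) : IsTypeG p M A y x z :=
  ⟨h.toIsTriple.swap, h.cy, h.cx, h.cz, h.cxy.symm, h.czx.symm, h.cyz.symm⟩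

theorem rotate (h : IsTypeG p M A x y z) : IsTypeG p M A y z x :=
  ⟨h.toIsTriple.rotate, h.cy, h.cz, h.cx, h.cyz, h.czx, h.cxy⟩

theorem inv (h : IsTypeG p M A x y z) : IsTypeG p M A x⁻¹ y⁻¹ z⁻¹ :=
  ⟨h.toIsTriple.inv, by simpa using h.cx, by simpa using h.cy, by simpa using h.cz,
    by simpa using h.cxy, by simpa using h.cyz, by simpa using h.czx⟩

theorem exists_of_mem (h : IsTypeG p M A x y z) {t : ℂ} (ht : t ∈ A) :
    ∃ y' z', IsTypeG p M A t y' z' := by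
  have h' := ht
  rw [h.eq, mem_invMultiset] at h'
  rcases h' with rfl | rfl | rfl | rfl | rfl | rfl
  exacts [⟨_, _, h⟩, ⟨_, _, h.rotate⟩, ⟨_, _, h.rotate.rotate⟩, ⟨_, _, h.inv⟩,
    ⟨_, _, h.inv.rotate⟩, ⟨_, _, h.inv.rotate.rotate⟩]

theorem mul_pow_eq_one (h : IsTypeG p M A x y z) : x ^ M * y ^ M * z ^ M = 1 := by
  rw [← mul_pow, ← mul_pow, h.prod, one_pow]

theorem inv_ne_y (h : IsTypeG p M A x y z) : (x ^ M)⁻¹ ≠ y ^ M := by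
  intro h1
  have := h.mul_pow_eq_one
  rw [← h1, mul_inv_cancel₀ (pow_ne_zero _ h.x_ne_zero), one_mul] at this
  exact h.cz this

/-- The class of `x` is not its own inverse as `p` is odd, and not inverse to another member's
class, since the remaining class would then be trivial. So `x` is alone in its class. -/
theorem classSum_x (h : IsTypeG p M A x y z) (hp : p.Prime) (hp3 : 3 ≤ p) :
    classSum M (x ^ M) A = x := by
  have h2 : (x ^ M)⁻¹ ≠ x ^ M := by
    have hprim : IsPrimitiveRoot (x ^ M) p :=
      isPrimitiveRoot_of_pow_prime hp (by rw [← pow_mul, mul_comm, h.hx]) h.cx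
    have := (hprim.zpow_eq_zpow_iff (by omega) (-1) 1).not.mpr (by
      simpa using Int.not_natCast_dvd_of_lt 2 (by omega) (by omega : 2 < p))
    simpa using this
  have h3 := h.swap.inv_ne_y
  have h4 := h.rotate.rotate.inv_ne_y
  rw [h.eq, classSum_invMultiset, if_pos rfl, if_neg h.cxy.symm, if_neg h.czx, if_neg h2,
    if_neg h3, if_neg h4]
  simp

theorem classSum_of_mem (h : IsTypeG p M A x y z) (hp : p.Prime) (hp3 : 3 ≤ p) {t : ℂ}
    (ht : t ∈ A) : classSum M (t ^ M) A = t := by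
  obtain ⟨y', z', h'⟩ := h.exists_of_mem ht
  exact h'.classSum_x hp hp3

end IsTypeG

/-! ### Relations that split class by class, for primes at least five. -/

/-- Two multisets whose classes modulo the `M`-th roots of unity have the same sums, which have
no element in common and do not contain `-1`. -/
structure ClassDisjoint (p M : ℕ) (A B : Multiset ℂ) : Prop where
  classSum_eq : ∀ ε : ℂ, ε ^ p = 1 → classSum M ε A = classSum M ε B
  left : -1 ∉ A
  right : -1 ∉ B
  disj : ∀ t ∈ A, t ∉ B

theorem ClassDisjoint.symm {p M : ℕ} {A B : Multiset ℂ} (h : ClassDisjoint p M A B) :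
    ClassDisjoint p M B A :=
  ⟨fun ε hε => (h.classSum_eq ε hε).symm, h.right, h.left, fun t ht ht' => h.disj t ht' ht⟩

theorem IsTypeL.eq_of_classSum_ne_zero {p M : ℕ} {A : Multiset ℂ} {x y z a ε : ℂ}
    (h : IsTypeL p M A x y z a) (hε : classSum M ε A ≠ 0) : ε = 1 ∨ ε = a ∨ ε = a⁻¹ := by
  by_contra! h'
  exact hε (h.classSum_other h'.1 h'.2.1 h'.2.2)

theorem IsTypeD.eq_of_classSum_ne_zero {p M : ℕ} {A : Multiset ℂ} {x y z a ε : ℂ}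
    (h : IsTypeD p M A x y z a) (hε : classSum M ε A ≠ 0) :
    ε = a ∨ ε = a⁻¹ ∨ ε = (a ^ 2)⁻¹ ∨ ε = a ^ 2 := by
  by_contra! h'
  exact hε (h.classSum_other h'.1 h'.2.1 h'.2.2.1 h'.2.2.2)

theorem eq_or_eq_inv_of_add_inv_eq {x u : ℂ} (hx : x ≠ 0) (hu : u ≠ 0)
    (h : x + x⁻¹ = u + u⁻¹) : x = u ∨ x = u⁻¹ := by
  have : (x - u) * (x - u⁻¹) = 0 := by
    linear_combination x * h - mul_inv_cancel₀ hx + mul_inv_cancel₀ hu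
  rcases mul_eq_zero.mp this with h | h
  · exact Or.inl (sub_eq_zero.mp h)
  · exact Or.inr (sub_eq_zero.mp h)

theorem sq_eq_neg_one_of_add_inv_eq_zero {x : ℂ} (hx : x ≠ 0) (h : x + x⁻¹ = 0) : x ^ 2 = -1 := by
  linear_combination x * h - mul_inv_cancel₀ hx

theorem mul_eq_sq_of_add_eq {u v z : ℂ} (hu : u ≠ 0) (hv : v ≠ 0) (hz : z ≠ 0) (h : u + v = z)
    (h' : u⁻¹ + v⁻¹ = z⁻¹) : u * v = z ^ 2 := by
  field_simp at h'
  linear_combination -h' + z * h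

namespace ClassDisjoint

variable {p M : ℕ} {A B : Multiset ℂ} {x y z u v w a b : ℂ}

/-- The trivial classes give `x + x⁻¹ = u + u⁻¹`, hence a common element. -/
theorem typeL_typeL (h : ClassDisjoint p M A B) (hp : 3 ≤ p) (hA : IsTypeL p M A x y z a)
    (hB : IsTypeL p M B u v w b) : False := by
  have := h.classSum_eq 1 (one_pow _)
  rw [hA.classSum_one hp, hB.classSum_one hp] at this
  rcases eq_or_eq_inv_of_add_inv_eq hA.x_ne_zero hB.x_ne_zero this with h1 | h1
  · exact h.disj x hA.x_mem (h1 ▸ hB.x_mem)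
  · exact h.disj x hA.x_mem (h1 ▸ hB.x_inv_mem)

/-- The class of `b` gives `v + w⁻¹ = 0`, so `vw = -1` and `u = -1`. -/
theorem trivial_typeL (h : ClassDisjoint p M A B) (hp : 3 ≤ p) (hA : ∀ t ∈ A, t ^ M = 1)
    (hB : IsTypeL p M B u v w b) : False := by
  have := h.classSum_eq b hB.prim.pow_eq_one
  rw [hB.classSum_self hp, classSum_eq_zero fun t ht => by
    rw [hA t ht]; exact (hB.ne_one hp).symm] at this
  refine h.right (hB.toIsTriple.neg_one_mem_of_mul_eq ?_)
  linear_combination -w * this - mul_inv_cancel₀ hB.z_ne_zero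

theorem trivial_typeD (h : ClassDisjoint p M A B) (hp : 5 ≤ p) (hA : ∀ t ∈ A, t ^ M = 1)
    (hB : IsTypeD p M B u v w b) : False := by
  have := h.classSum_eq (b ^ 2)⁻¹ (by
    rw [inv_pow, ← pow_mul, mul_comm, pow_mul, hB.prim.pow_eq_one]; simp)
  rw [hB.classSum_sq_inv hp, classSum_eq_zero fun t ht => by
    rw [hA t ht]
    intro h1
    exact hB.prim.pow_ne_one_of_pos_of_lt two_ne_zero (by omega) (inv_eq_one.mp h1.symm)] at this
  exact hB.z_ne_zero this.symm

/-- Type D has no trivial class, so `x + x⁻¹ = 0`. The isolated `w` and `w⁻¹` must match `y + z⁻¹`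
and `z + y⁻¹` in some order, but the product of these is `2 + x + x⁻¹ = 2`, not `1`. -/
theorem typeL_typeD (h : ClassDisjoint p M A B) (hp : 5 ≤ p) (hA : IsTypeL p M A x y z a)
    (hB : IsTypeD p M B u v w b) : False := by
  have h1 := h.classSum_eq 1 (one_pow _)
  rw [hA.classSum_one (by omega), hB.classSum_one hp] at h1
  have e : ((b ^ 2)⁻¹) ^ p = 1 := by
    rw [inv_pow, ← pow_mul, mul_comm, pow_mul, hB.prim.pow_eq_one]; simp
  have h2 := h.classSum_eq (b ^ 2)⁻¹ e
  rw [hB.classSum_sq_inv hp] at h2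
  have h3 := h.classSum_eq (b ^ 2) (by simpa using e)
  have h4 := hB.inv.classSum_sq_inv hp
  rw [inv_pow, inv_inv] at h4
  rw [h4] at h3
  have hy := hA.y_ne_zero
  have hz := hA.z_ne_zero
  have key : (y + z⁻¹) * (z + y⁻¹) = 1 → False := by
    intro h5
    have hx1 : x⁻¹ = y * z := by
      have := hA.x_ne_zero
      field_simp
      linear_combination -hA.prod
    have hx2 : (y * z)⁻¹ = x := by rw [← hx1, inv_inv]
    have h6 : (y + z⁻¹) * (z + y⁻¹) = 2 + y * z + (y * z)⁻¹ := by field_simp; ring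
    rw [h6, hx2, ← hx1] at h5
    have : (1 : ℂ) = 0 := by linear_combination h5 - h1
    exact one_ne_zero this
  rcases hA.eq_of_classSum_ne_zero (h2.trans_ne hB.z_ne_zero) with h5 | h5 | h5
  · exact hB.prim.pow_ne_one_of_pos_of_lt two_ne_zero (by omega) (inv_eq_one.mp h5)
  · rw [h5, hA.classSum_self (by omega)] at h2
    rw [show b ^ 2 = a⁻¹ by rw [← h5, inv_inv], hA.classSum_inv (by omega)] at h3
    exact key (by rw [h2, h3, mul_inv_cancel₀ hB.z_ne_zero])
  · rw [h5, hA.classSum_inv (by omega)] at h2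
    rw [show b ^ 2 = a by rw [← inv_inv a, ← h5, inv_inv], hA.classSum_self (by omega)] at h3
    exact key (by rw [h2, h3, inv_mul_cancel₀ hB.z_ne_zero])

theorem typeD_typeD_self (h : ClassDisjoint p M A B) (hp : 5 ≤ p) (hA : IsTypeD p M A x y z a)
    (hB : IsTypeD p M B u v w a) : False := by
  have h1 := h.classSum_eq (a ^ 2)⁻¹ (by
    rw [inv_pow, ← pow_mul, mul_comm, pow_mul, hB.prim.pow_eq_one]; simp)
  rw [hA.classSum_sq_inv hp, hB.classSum_sq_inv hp] at h1
  exact h.disj z hA.z_mem (h1 ▸ hB.z_mem)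

/-- The isolated `w` lies in the class `(b²)⁻¹ = a⁴`, which `A` must also occupy; this forces `a⁵ =
1`. Then `z = u + v` and `w⁻¹ = x + y`, with the inverse relations, give `z⁵ = 1`, impossible when
`5 ∣ M`. This is why `p = 5` needs `25 ∣ N`. -/
theorem typeD_typeD_sq (h : ClassDisjoint p M A B) (hpp : p.Prime) (hp : 5 ≤ p) (hpM : p ≠ 5 ∨ 5 ∣ M)
    (hA : IsTypeD p M A x y z a) (hB : IsTypeD p M B u v w b) (hb : b = (a ^ 2)⁻¹) : False := by
  have ha := hA.prim.pow_eq_one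
  have ha0 : a ≠ 0 := hA.prim.ne_zero (by omega)
  have e1 : ((a ^ 2)⁻¹) ^ p = 1 := by
    rw [inv_pow, ← pow_mul, mul_comm, pow_mul, ha]; simp
  have h1 := h.classSum_eq (a ^ 2)⁻¹ e1
  have h1' := h.classSum_eq (a ^ 2) (by simpa using e1)
  have k1 := hA.inv.classSum_sq_inv hp
  rw [inv_pow, inv_inv] at k1
  rw [hA.classSum_sq_inv hp, ← hb, hB.classSum_self hp] at h1
  have k2 : a ^ 2 = b⁻¹ := by rw [hb, inv_inv]
  rw [k1, k2, hB.inv.classSum_self hp] at h1'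
  have m1 := mul_eq_sq_of_add_eq hB.x_ne_zero hB.y_ne_zero hA.z_ne_zero h1.symm h1'.symm
  have e2 : ((b ^ 2)⁻¹) ^ p = 1 := by
    rw [inv_pow, ← pow_mul, mul_comm, pow_mul, hB.prim.pow_eq_one]; simp
  have h2 := h.classSum_eq (b ^ 2)⁻¹ e2
  have h2' := h.classSum_eq (b ^ 2) (by simpa using e2)
  have k3 := hB.inv.classSum_sq_inv hp
  rw [inv_pow, inv_inv] at k3
  rw [hB.classSum_sq_inv hp] at h2
  rw [k3] at h2'
  have hb2 : (b ^ 2)⁻¹ = a ^ 4 := by rw [hb, inv_pow, inv_inv]; ring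
  have ne : ∀ k, 0 < k → k < 5 → a ^ k ≠ 1 := fun k hk hk' =>
    hA.prim.pow_ne_one_of_pos_of_lt hk.ne' (by omega)
  have h5 : a ^ 5 = 1 := by
    rw [hb2] at h2
    rcases hA.eq_of_classSum_ne_zero (h2.trans_ne hB.z_ne_zero) with h3 | h3 | h3 | h3
    · exact absurd (mul_left_cancel₀ ha0 (by linear_combination h3)) (ne 3 (by omega) (by omega))
    · linear_combination a * h3 + mul_inv_cancel₀ ha0
    · exfalso
      have h6 : a ^ 6 = 1 := by linear_combination a ^ 2 * h3 + mul_inv_cancel₀ (pow_ne_zero 2 ha0)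
      have h7 := hA.prim.dvd_of_pow_eq_one 6 h6
      have h8 := Nat.le_of_dvd (by norm_num) h7
      interval_cases p
      · omega
      · exact absurd hpp (by norm_num)
    · exact absurd (mul_left_cancel₀ (pow_ne_zero 2 ha0) (by linear_combination h3))
        (ne 2 (by omega) (by omega))
  have hp5 : p = 5 := le_antisymm (Nat.le_of_dvd (by norm_num) (hA.prim.dvd_of_pow_eq_one 5 h5)) hp
  have hai : a⁻¹ = a ^ 4 := by field_simp; linear_combination -h5
  rw [hb2, ← hai, hA.inv.classSum_self hp] at h2
  rw [show b ^ 2 = a by rw [hb, inv_pow]; field_simp; linear_combination -h5,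
    hA.classSum_self hp] at h2'
  have m2 := mul_eq_sq_of_add_eq hA.x_ne_zero hA.y_ne_zero (inv_ne_zero hB.z_ne_zero) h2'
    (by rw [h2, inv_inv])
  have hz5 : z ^ 5 = 1 := by
    have hw : w ≠ 0 := hB.z_ne_zero
    have q1 : z ^ 2 * w = 1 := by rw [← m1]; exact hB.prod
    have q2 : (w⁻¹) ^ 2 * z = 1 := by rw [← m2]; exact hA.prod
    have q3 : w⁻¹ = z ^ 2 := by field_simp; linear_combination -q1
    rw [q3] at q2
    linear_combination q2
  have : z ^ M = 1 := by
    obtain ⟨m, rfl⟩ := hpM.resolve_left (by simp [hp5])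
    rw [pow_mul, hz5, one_pow]
  rw [hA.cz, inv_eq_one] at this
  exact ne 2 (by omega) (by omega) this

theorem typeD_typeD (h : ClassDisjoint p M A B) (hp : p.Prime) (hp5 : 5 ≤ p)
    (hpM : p ≠ 5 ∨ 5 ∣ M)
    (hA : IsTypeD p M A x y z a) (hB : IsTypeD p M B u v w b) : False := by
  have e1 : ((a ^ 2)⁻¹) ^ p = 1 := by
    rw [inv_pow, ← pow_mul, mul_comm, pow_mul, hA.prim.pow_eq_one]; simp
  have h1 := h.classSum_eq (a ^ 2)⁻¹ e1
  rw [hA.classSum_sq_inv hp5] at h1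
  have sq : ∀ {c d : ℂ}, c ^ p = 1 → d ^ p = 1 → c ^ 2 = d ^ 2 → c = d := by
    intro c d hc hd hcd
    obtain ⟨k, hk⟩ := hp.odd_of_ne_two (by omega)
    have key : ∀ {c : ℂ}, c ^ p = 1 → c = (c ^ 2) ^ (k + 1) := by
      intro c hc
      rw [← pow_mul, show 2 * (k + 1) = p + 1 by omega, pow_succ, hc, one_mul]
    rw [key hc, key hd, hcd]
  have ha := hA.prim.pow_eq_one
  have hb := hB.prim.pow_eq_one
  rcases hB.eq_of_classSum_ne_zero (h1.symm.trans_ne hA.z_ne_zero) with h2 | h2 | h2 | h2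
  · exact h.typeD_typeD_sq hp hp5 hpM hA hB h2.symm
  · exact h.typeD_typeD_sq hp hp5 hpM hA hB.inv h2.symm
  · have : a = b := sq ha hb (inv_injective h2)
    subst this
    exact h.typeD_typeD_self hp5 hA hB
  · have : a⁻¹ = b := sq (by simp [ha]) hb (by rw [← h2, inv_pow])
    subst this
    exact h.symm.typeD_typeD_self hp5 hB.inv (by simpa using hA)

theorem typeG_classSum_ne_zero (h : ClassDisjoint p M A B) (hp : p.Prime) (hp3 : 3 ≤ p)
    (hA : IsTypeG p M A x y z) : classSum M (x ^ M) B ≠ 0 := by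
  rw [← h.classSum_eq (x ^ M) (by rw [← pow_mul, mul_comm, hA.hx]), hA.classSum_x hp hp3]
  exact hA.x_ne_zero

/-- `B` must occupy the three classes of `x`, `y`, `z`, which are nontrivial and pairwise neither
equal nor inverse. Types L and D offer only one and two inverse pairs of nontrivial classes, and
against type G the isolated elements coincide. -/
theorem typeG_false (h : ClassDisjoint p M A B) (hp : p.Prime) (hp3 : 3 ≤ p)
    (hA : IsTypeG p M A x y z) (hB : IsTriple (p * M) B u v w) : False := by
  have hx := h.typeG_classSum_ne_zero hp hp3 hA
  have hy := h.typeG_classSum_ne_zero hp hp3 hA.rotate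
  have hz := h.typeG_classSum_ne_zero hp hp3 hA.rotate.rotate
  have n1 := hA.inv_ne_y
  have n2 := hA.rotate.inv_ne_y
  have n3 := hA.rotate.rotate.inv_ne_y
  have m1 := hA.swap.inv_ne_y
  have m2 := hA.rotate.swap.inv_ne_y
  have m3 := hA.rotate.rotate.swap.inv_ne_y
  rcases hB.types hp with hB | ⟨_, _, _, _, hB⟩ | ⟨_, _, _, _, hB⟩ | ⟨_, _, _, hB⟩
  · obtain ⟨t, ht, h1⟩ := exists_mem_of_classSum_ne_zero hx
    exact hA.cx (by rw [← h1, hB t ht])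
  · have hx := (hB.eq_of_classSum_ne_zero hx).resolve_left hA.cx
    have hy := (hB.eq_of_classSum_ne_zero hy).resolve_left hA.cy
    have cxy := hA.cxy
    rcases hx with hx | hx <;> rcases hy with hy | hy <;> simp [hx, hy] at n1 cxy
  · have hx := hB.eq_of_classSum_ne_zero hx
    have hy := hB.eq_of_classSum_ne_zero hy
    have hz := hB.eq_of_classSum_ne_zero hz
    have cxy := hA.cxy
    have cyz := hA.cyz
    have czx := hA.czx
    rcases hx with hx | hx | hx | hx <;> rcases hy with hy | hy | hy | hy <;>
      rcases hz with hz | hz | hz | hz <;>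
      simp only [hx, hy, hz, inv_inv, ne_eq, not_true_eq_false] at n1 n2 n3 cxy cyz czx
  · obtain ⟨t, ht, h1⟩ := exists_mem_of_classSum_ne_zero hx
    have h2 := h.classSum_eq (x ^ M) (by rw [← pow_mul, mul_comm, hA.hx])
    rw [hA.classSum_x hp hp3, ← h1, hB.classSum_of_mem hp hp3 ht] at h2
    exact h.disj x hA.x_mem (h2 ▸ ht)

theorem pow_eq_one_of_five_le (h : ClassDisjoint p M A B) (hp : p.Prime) (hp5 : 5 ≤ p)
    (hpM : p ≠ 5 ∨ 5 ∣ M) (hA : IsTriple (p * M) A x y z) (hB : IsTriple (p * M) B u v w) :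
    (∀ t ∈ A, t ^ M = 1) ∧ ∀ t ∈ B, t ^ M = 1 := by
  have hp3 : 3 ≤ p := by omega
  rcases hA.types hp with hA' | ⟨_, _, _, _, hA'⟩ | ⟨_, _, _, _, hA'⟩ | ⟨_, _, _, hA'⟩ <;>
    rcases hB.types hp with hB' | ⟨_, _, _, _, hB'⟩ | ⟨_, _, _, _, hB'⟩ | ⟨_, _, _, hB'⟩
  · exact ⟨hA', hB'⟩
  · exact (h.trivial_typeL hp3 hA' hB').elim
  · exact (h.trivial_typeD hp5 hA' hB').elim
  · exact (h.symm.typeG_false hp hp3 hB' hA).elim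
  · exact (h.symm.trivial_typeL hp3 hB' hA').elim
  · exact (h.typeL_typeL hp3 hA' hB').elim
  · exact (h.typeL_typeD hp5 hA' hB').elim
  · exact (h.symm.typeG_false hp hp3 hB' hA).elim
  · exact (h.symm.trivial_typeD hp5 hB' hA').elim
  · exact (h.symm.typeL_typeD hp5 hB' hA').elim
  · exact (h.typeD_typeD hp hp5 hpM hA' hB').elim
  · exact (h.symm.typeG_false hp hp3 hB' hA).elim
  all_goals exact (h.typeG_false hp hp3 hA' hB).elim

end ClassDisjoint

/-! ### Relations that split class by class, for the prime three. -/

section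

variable {p M : ℕ} {A B : Multiset ℂ} {x y z u v w a b : ℂ}

/-- Descent on the 2-part of `N`, splitting at `p = 2`. If `1` and `x` fall in the same class, so do
`r`, `s`, `t`, and `N` is halved. If they fall in different classes, three summands over two classes
leave one alone, and it equals `1` or `x`. -/
theorem mem_of_one_add_eq_sum {x : ℂ} (hx : x ^ 2 = -1) {r s t : ℂ} {N : ℕ} (hN : 0 < N)
    (h4 : 4 ∣ N) (hr : r ^ N = 1) (hs : s ^ N = 1) (ht : t ^ N = 1) (h : 1 + x = r + s + t) :
    (r = 1 ∨ s = 1 ∨ t = 1) ∨ (r = x ∨ s = x ∨ t = x) := by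
  induction N using Nat.strong_induction_on with
  | _ N ih =>
  have h2 : ∀ t : ℂ, t ^ N = 1 → t ≠ 0 := by
    rintro t ht rfl
    simp [hN.ne'] at ht
  obtain ⟨K, rfl⟩ := h4
  have hM : 0 < 2 * K := by omega
  have hN2 : 4 * K = 2 * (2 * K) := by ring
  have hx4 : x ^ 4 = 1 := by linear_combination (x ^ 2 - 1) * hx
  have hA : ∀ c ∈ ({1, x} : Multiset ℂ), c ^ (2 * (2 * K)) = 1 := by
    intro c hc
    simp only [Multiset.insert_eq_cons, Multiset.mem_cons, Multiset.mem_singleton] at hc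
    rcases hc with rfl | rfl
    · simp
    · rw [← hN2, pow_mul, hx4, one_pow]
  have hB : ∀ c ∈ ({r, s, t} : Multiset ℂ), c ^ (2 * (2 * K)) = 1 := by
    intro c hc
    simp only [Multiset.insert_eq_cons, Multiset.mem_cons, Multiset.mem_singleton] at hc
    rw [← hN2]
    rcases hc with rfl | rfl | rfl <;> assumption
  obtain ⟨C, e, hC, -, hsplit⟩ := exists_classSum_sub_eq Nat.prime_two hM hA hB (by
    simp [h, add_assoc])
  rw [hC ⟨K, rfl⟩] at hsplit
  have h1 := hsplit 1 (by simp)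
  have h1' := hsplit (-1) (by simp)
  have dich : ∀ {c : ℂ}, c ^ (4 * K) = 1 → c ^ (2 * K) = 1 ∨ c ^ (2 * K) = -1 := by
    intro c hc
    have : (c ^ (2 * K)) ^ 2 = 1 := by rw [← pow_mul, ← hc]; ring_nf
    exact mul_self_eq_one_iff.mp (by rw [← sq, this])
  have n1 : (1 : ℂ) ≠ -1 := by norm_num
  have n2 : (-1 : ℂ) ≠ 1 := by norm_num
  have r0 := h2 r hr
  have s0 := h2 s hs
  have t0 := h2 t ht
  -- `(1 + x) ^ 4 = -4`, so `1 + x` is not a root of unity.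
  have norm : ∀ {c : ℂ}, c ^ (4 * K) = 1 → 1 + x ≠ c := by
    intro c hc h0
    have h5 : (1 + x) ^ 4 = -4 := by linear_combination (x ^ 2 + 4 * x + 5) * hx
    have h6 : (c ^ 4) ^ K = 1 := by rw [← pow_mul, hc]
    rw [← h0, h5] at h6
    have := congrArg norm h6
    rw [norm_pow] at this
    norm_num at this
    rcases Nat.eq_zero_or_pos K with rfl | hK
    · omega
    · exact absurd this (one_lt_pow₀ (by norm_num) hK.ne').ne'
  have hxK : x ^ (2 * K) = (-1) ^ K := by rw [pow_mul, hx]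
  simp only [classSum, Multiset.insert_eq_cons, Multiset.map_cons, Multiset.map_singleton,
    Multiset.sum_cons, Multiset.sum_singleton, one_pow, zero_mul, hxK] at h1 h1'
  rcases Nat.even_or_odd K with hK | hK
  · rw [hK.neg_one_pow] at h1 h1'
    rcases dich hr with hr' | hr' <;> rcases dich hs with hs' | hs' <;>
      rcases dich ht with ht' | ht' <;>
      simp only [hr', hs', ht', if_true, n1, n2, if_false, add_zero, zero_add, zero_sub, sub_zero,
        neg_eq_zero] at h1 h1'
    · obtain ⟨m, rfl⟩ := hK
      exact ih (2 * (m + m)) (by omega) (by omega) ⟨m, by ring⟩ hr' hs' ht'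
    · exact absurd h1' t0
    · exact absurd h1' s0
    · exact absurd (by linear_combination h1) (norm hr)
    · exact absurd h1' r0
    · exact absurd (by linear_combination h1) (norm hs)
    · exact absurd (by linear_combination h1) (norm ht)
    · have : x = -1 := by linear_combination h1
      rw [this] at hx
      norm_num at hx
  · rw [hK.neg_one_pow] at h1 h1'
    have x0 : x ≠ 0 := by rintro rfl; norm_num at hx
    rcases dich hr with hr' | hr' <;> rcases dich hs with hs' | hs' <;>
      rcases dich ht with ht' | ht' <;>
      simp only [hr', hs', ht', if_true, n1, n2, if_false, add_zero, zero_add, sub_zero]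
        at h1 h1'
    · exact absurd h1' x0
    · exact Or.inr (Or.inr (Or.inr (by linear_combination -h1')))
    · exact Or.inr (Or.inr (Or.inl (by linear_combination -h1')))
    · exact Or.inl (Or.inl (by linear_combination -h1))
    · exact Or.inr (Or.inl (by linear_combination -h1'))
    · exact Or.inl (Or.inr (Or.inl (by linear_combination -h1)))
    · exact Or.inl (Or.inr (Or.inr (by linear_combination -h1)))
    · exact absurd h1 one_ne_zero

/-- For `p = 3` one has `(a²)⁻¹ = a`, so all three members share the class `a`. -/
theorem IsTypeD.classSum_self_three (h : IsTypeD 3 M A x y z a) : classSum M a A = x + y + z := by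
  have h3 := h.prim.pow_eq_one
  have h0 : a ≠ 0 := h.prim.ne_zero (by norm_num)
  have e1 : (a ^ 2)⁻¹ = a := by field_simp; linear_combination -h3
  have e2 : a⁻¹ ≠ a := by
    intro e
    refine h.prim.pow_ne_one_of_pos_of_lt two_ne_zero (by norm_num) ?_
    linear_combination -a * e + mul_inv_cancel₀ h0
  rw [h.eq, classSum_invMultiset, h.cx, h.cy, h.cz, e1]
  simp [e2]

theorem IsTypeD.classSum_one_three (h : IsTypeD 3 M A x y z a) : classSum M 1 A = 0 := by
  have h3 := h.prim.pow_eq_one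
  have h0 : a ≠ 0 := h.prim.ne_zero (by norm_num)
  have e1 : (a ^ 2)⁻¹ = a := by field_simp; linear_combination -h3
  have e2 : a ≠ 1 := h.prim.ne_one (by norm_num)
  rw [h.eq, classSum_invMultiset, h.cx, h.cy, h.cz, e1]
  simp [e2]

/-- Three distinct nontrivial classes are needed, and there are only two. -/
theorem IsTypeG.three_false (h : IsTypeG 3 M A x y z) : False := by
  have hx : IsPrimitiveRoot (x ^ M) 3 :=
    isPrimitiveRoot_of_pow_prime Nat.prime_three (by rw [← pow_mul, mul_comm, h.hx]) h.cx
  have key : ∀ {b : ℂ}, b ^ 3 = 1 → b ≠ 1 → b ≠ x ^ M → b = (x ^ M)⁻¹ := by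
    intro b hb h1 h2
    obtain ⟨i, hi, rfl⟩ := hx.eq_pow_of_pow_eq_one hb
    interval_cases i
    · simp at h1
    · simp at h2
    · exact eq_inv_of_mul_eq_one_left (by rw [← hx.pow_eq_one]; ring)
  exact h.cyz ((key (by rw [← pow_mul, mul_comm, h.hy]) h.cy h.cxy.symm).trans
    (key (by rw [← pow_mul, mul_comm, h.hz]) h.cz h.czx).symm)

/-- The elementary symmetric functions of a triple are determined by its sum and its inverse
sum. -/
theorem mem_of_sum_eq (hp1 : x * y * z = 1) (hp2 : u * v * w = 1)
    (h : x + y + z = u + v + w) (h' : x⁻¹ + y⁻¹ + z⁻¹ = u⁻¹ + v⁻¹ + w⁻¹) :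
    x = u ∨ x = v ∨ x = w := by
  have e : ∀ {x y z : ℂ}, x * y * z = 1 → x⁻¹ + y⁻¹ + z⁻¹ = y * z + x * z + x * y := by
    intro x y z hp
    rw [inv_eq_of_mul_eq_one_right (by linear_combination hp : x * (y * z) = 1),
      inv_eq_of_mul_eq_one_right (by linear_combination hp : y * (x * z) = 1),
      inv_eq_of_mul_eq_one_right (by linear_combination hp : z * (x * y) = 1)]
  rw [e hp1, e hp2] at h'
  have : (x - u) * ((x - v) * (x - w)) = 0 := by
    linear_combination x ^ 2 * h - x * h' + hp1 - hp2
  rcases mul_eq_zero.mp this with h | h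
  · exact Or.inl (sub_eq_zero.mp h)
  rcases mul_eq_zero.mp h with h | h
  · exact Or.inr (Or.inl (sub_eq_zero.mp h))
  · exact Or.inr (Or.inr (sub_eq_zero.mp h))

namespace ClassDisjoint

/-- Both `u + v + w` and its inverse analogue vanish, so `u`, `v`, `w` are roots of `T³ - 1`; as `3
∣ M`, their class would be trivial. -/
theorem three_trivial_typeD (h : ClassDisjoint 3 M A B) (hM : 3 ∣ M) (hA : ∀ t ∈ A, t ^ M = 1)
    (hB : IsTypeD 3 M B u v w b) : False := by
  have hb := hB.prim.pow_eq_one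
  have hb1 : b ≠ 1 := hB.prim.ne_one (by norm_num)
  have h1 := h.classSum_eq b hb
  have h2 := h.classSum_eq b⁻¹ (by simp [hb])
  rw [hB.classSum_self_three, classSum_eq_zero fun t ht => by rw [hA t ht]; exact hb1.symm] at h1
  rw [hB.inv.classSum_self_three, classSum_eq_zero fun t ht => by
    rw [hA t ht]; exact (inv_ne_one.mpr hb1).symm] at h2
  have u0 := hB.x_ne_zero
  have v0 := hB.y_ne_zero
  have w0 := hB.z_ne_zero
  have hp := hB.prod
  have e2 : v * w + u * w + u * v = 0 := by
    field_simp at h2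
    linear_combination -h2
  have hu : u ^ 3 = 1 := by linear_combination -u ^ 2 * h1 - u * e2 + hp
  obtain ⟨m, rfl⟩ := hM
  have := hB.cx
  rw [pow_mul, hu, one_pow] at this
  exact hb1 this.symm

/-- The trivial class gives `x² = -1`, and the class `a` gives `y(1 + x) = u + v + w`. Dividing by
`y` reduces to `mem_of_one_add_eq_sum`, whose outcomes are common elements `y` or `xy = z⁻¹`. -/
theorem three_typeL_typeD (h : ClassDisjoint 3 M A B) (hM : 0 < M)
    (hA : IsTypeL 3 M A x y z a) (hB : IsTypeD 3 M B u v w a) : False := by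
  have h1 := h.classSum_eq 1 (one_pow _)
  have h2 := h.classSum_eq a hA.prim.pow_eq_one
  rw [hA.classSum_one le_rfl, hB.classSum_one_three] at h1
  rw [hA.classSum_self le_rfl, hB.classSum_self_three] at h2
  have hx := sq_eq_neg_one_of_add_inv_eq_zero hA.x_ne_zero h1
  have hy := hA.y_ne_zero
  have hz := hA.z_ne_zero
  have hzi : z⁻¹ = x * y := by field_simp; linear_combination -hA.prod
  have key := mem_of_one_add_eq_sum hx (r := u / y) (s := v / y) (t := w / y)
    (N := 4 * (3 * M)) (by omega) ⟨_, rfl⟩ (by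
      rw [mul_comm, pow_mul, div_pow, hB.hx, hA.hy]; simp) (by
      rw [mul_comm, pow_mul, div_pow, hB.hy, hA.hy]; simp) (by
      rw [mul_comm, pow_mul, div_pow, hB.hz, hA.hy]; simp) (by
      rw [hzi] at h2
      field_simp
      linear_combination h2)
  simp only [div_eq_iff hy, one_mul, ← hzi] at key
  rcases key with (k | k | k) | (k | k | k)
  · exact h.disj _ hA.y_mem (k ▸ hB.x_mem)
  · exact h.disj _ hA.y_mem (k ▸ hB.y_mem)
  · exact h.disj _ hA.y_mem (k ▸ hB.z_mem)
  · exact h.disj _ hA.z_inv_mem (k ▸ hB.x_mem)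
  · exact h.disj _ hA.z_inv_mem (k ▸ hB.y_mem)
  · exact h.disj _ hA.z_inv_mem (k ▸ hB.z_mem)

theorem three_typeD_typeD (h : ClassDisjoint 3 M A B)
    (hA : IsTypeD 3 M A x y z a) (hB : IsTypeD 3 M B u v w a) : False := by
  have h1 := h.classSum_eq a hA.prim.pow_eq_one
  have h2 := h.classSum_eq a⁻¹ hA.inv.prim.pow_eq_one
  rw [hA.classSum_self_three, hB.classSum_self_three] at h1
  rw [hA.inv.classSum_self_three, hB.inv.classSum_self_three] at h2
  rcases mem_of_sum_eq hA.prod hB.prod h1 h2 with k | k | k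
  · exact h.disj _ hA.x_mem (k ▸ hB.x_mem)
  · exact h.disj _ hA.x_mem (k ▸ hB.y_mem)
  · exact h.disj _ hA.x_mem (k ▸ hB.z_mem)

theorem pow_eq_one_of_three (h : ClassDisjoint 3 M A B) (hM0 : 0 < M) (hM : 3 ∣ M)
    (hA : IsTriple (3 * M) A x y z) (hB : IsTriple (3 * M) B u v w) :
    (∀ t ∈ A, t ^ M = 1) ∧ ∀ t ∈ B, t ^ M = 1 := by
  have cube : ∀ {a b : ℂ}, IsPrimitiveRoot a 3 → IsPrimitiveRoot b 3 → a = b ∨ a = b⁻¹ := by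
    intro a b ha hb
    obtain ⟨i, hi, rfl⟩ := hb.eq_pow_of_pow_eq_one ha.pow_eq_one
    interval_cases i
    · exact absurd ha (by rw [pow_zero]; intro h; exact h.ne_one (by norm_num) rfl)
    · simp
    · exact Or.inr (eq_inv_of_mul_eq_one_left (by rw [← hb.pow_eq_one]; ring))
  rcases hA.types Nat.prime_three with hA | ⟨_, _, _, _, hA⟩ | ⟨_, _, _, _, hA⟩ | ⟨_, _, _, hA⟩ <;>
    rcases hB.types Nat.prime_three with hB | ⟨_, _, _, _, hB⟩ | ⟨_, _, _, _, hB⟩ | ⟨_, _, _, hB⟩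
  · exact ⟨hA, hB⟩
  · exact (h.trivial_typeL le_rfl hA hB).elim
  · exact (h.three_trivial_typeD hM hA hB).elim
  · exact hB.three_false.elim
  · exact (h.symm.trivial_typeL le_rfl hB hA).elim
  · exact (h.typeL_typeL le_rfl hA hB).elim
  · rcases cube hA.prim hB.prim with rfl | rfl
    · exact (h.three_typeL_typeD hM0 hA hB).elim
    · exact (h.three_typeL_typeD hM0 hA hB.inv).elim
  · exact hB.three_false.elim
  · exact (h.symm.three_trivial_typeD hM hB hA).elim
  · rcases cube hA.prim hB.prim with rfl | rfl
    · exact (h.symm.three_typeL_typeD hM0 hB hA).elim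
    · exact (h.symm.three_typeL_typeD hM0 hB.inv hA).elim
  · rcases cube hA.prim hB.prim with rfl | rfl
    · exact (h.three_typeD_typeD hA hB).elim
    · exact (h.three_typeD_typeD hA hB.inv).elim
  · exact hB.three_false.elim
  all_goals exact hA.three_false.elim

end ClassDisjoint

end

/-! ### Relations that split class by class, for the prime two. -/

section

variable {p M : ℕ} {A B : Multiset ℂ} {x y z u v w a b : ℂ}

theorem IsTriple.types_two (h : IsTriple (2 * M) A x y z) :
    (∀ t ∈ A, t ^ M = 1) ∨ ∃ x y z, IsTypeL 2 M A x y z (-1) := by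
  have neg : ∀ {a : ℂ}, IsPrimitiveRoot a 2 → a = -1 := fun ha => ha.eq_neg_one_of_two_right
  rcases h.types Nat.prime_two with h | ⟨_, _, _, _, h⟩ | ⟨x, y, z, _, h⟩ | ⟨x, y, z, h⟩
  · exact Or.inl h
  · obtain rfl := neg h.prim
    exact Or.inr ⟨_, _, _, h⟩
  · obtain rfl := neg h.prim
    exact Or.inr ⟨z, x, y, h.toIsTriple.rotate.rotate, h.prim, by rw [h.cz]; norm_num, h.cx,
      by rw [h.cy]; norm_num⟩
  · have e : ∀ {t : ℂ}, t ^ (2 * M) = 1 → t ^ M ≠ 1 → t ^ M = -1 := fun ht h1 =>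
      neg (isPrimitiveRoot_of_pow_prime Nat.prime_two (by rw [← pow_mul, mul_comm, ht]) h1)
    exact absurd ((e h.hx h.cx).trans (e h.hy h.cy).symm) h.cxy

theorem IsTypeL.classSum_one_two (h : IsTypeL 2 M A x y z (-1)) : classSum M 1 A = x + x⁻¹ := by
  rw [h.eq, classSum_invMultiset, h.cx, h.cy, h.cz]
  norm_num

theorem IsTypeL.classSum_neg_one_two (h : IsTypeL 2 M A x y z (-1)) :
    classSum M (-1) A = (y + z) * (1 + x) := by
  have hy := h.y_ne_zero
  have hz := h.z_ne_zero
  have e : y⁻¹ + z⁻¹ = (y + z) * x := by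
    field_simp
    linear_combination -(y + z) * h.prod
  rw [h.eq, classSum_invMultiset, h.cx, h.cy, h.cz]
  norm_num
  linear_combination e

/-- A triple is not of the form `{ν, -ν, -ν⁻²}` against roots of unity of smaller two-power
order. -/
theorem sum_ne_of_two_adic (hM : 16 ∣ M) (hM0 : 0 < M) (hA : IsTriple M A u v w) {x : ℂ}
    (hx : x ^ (M / 2) = -1) : A.sum ≠ x + x⁻¹ := by
  obtain ⟨m, rfl⟩ := hM
  have hm : 0 < m := by omega
  rw [show 16 * m / 2 = 8 * m by omega] at hx
  intro hs
  have hx0 : x ≠ 0 := by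
    rintro rfl
    rw [zero_pow (by omega)] at hx
    norm_num at hx
  have e16 : 16 * m = 2 * (8 * m) := by ring
  have hxm : x ^ (2 * (8 * m)) = 1 := by rw [mul_comm, pow_mul, hx]; norm_num
  rw [e16] at hA
  obtain ⟨C, s, hC, -, hsp⟩ := exists_classSum_sub_eq (A := A) (B := {x, x⁻¹}) Nat.prime_two
    (by omega : 0 < 8 * m) hA.pow_eq_one (by
      intro t ht
      simp only [Multiset.insert_eq_cons, Multiset.mem_cons, Multiset.mem_singleton] at ht
      rcases ht with rfl | rfl <;> simp [hxm]) (by simpa using hs)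
  rw [hC ⟨4 * m, by ring⟩] at hsp
  have h1 := hsp 1 (by norm_num)
  have h2 := hsp (-1) (by norm_num)
  have n1 : (-1 : ℂ) ≠ 1 := by norm_num
  have b1 : classSum (8 * m) 1 {x, x⁻¹} = 0 := by simp [classSum, hx, n1]
  have b2 : classSum (8 * m) (-1) {x, x⁻¹} = x + x⁻¹ := by simp [classSum, hx]
  rw [b1, sub_zero, zero_mul] at h1
  rw [b2, zero_mul] at h2
  rcases hA.types_two with hA | ⟨x', y, z, hA⟩
  · rw [classSum_eq_zero fun t ht => by rw [hA t ht]; exact n1.symm] at h2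
    have h3 := sq_eq_neg_one_of_add_inv_eq_zero hx0 (by linear_combination -h2)
    have : x ^ (8 * m) = 1 := by
      rw [show 8 * m = 2 * (2 * (2 * m)) by ring, pow_mul, h3, pow_mul]; norm_num
    rw [hx] at this
    exact n1 this
  · rw [hA.classSum_one_two] at h1
    rw [hA.classSum_neg_one_two] at h2
    have hx' := sq_eq_neg_one_of_add_inv_eq_zero hA.x_ne_zero h1
    have hx4 : x' ^ 4 = 1 := by linear_combination (x' ^ 2 - 1) * hx'
    have hyz : y * z = -x' := by linear_combination -x' * hA.prod + y * z * hx'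
    set κ := x' * y ^ 2 with hκ
    have hy := hA.y_ne_zero
    have hκ0 : κ ≠ 0 := mul_ne_zero hA.x_ne_zero (pow_ne_zero 2 hy)
    have hκi : κ⁻¹ = x' * z ^ 2 := by
      apply inv_eq_of_mul_eq_one_right
      rw [hκ]
      linear_combination (x' * y * z + 1) * hA.prod
    -- The square of `(y + z)(1 + x') = x + x⁻¹`, using `(1 + x')² = 2x'` and `yz = -x'`.
    have hsum : 2 + 2 * (κ + κ⁻¹) = x ^ 2 + (x ^ 2)⁻¹ := by
      have h3 : (y + z) ^ 2 * (2 * x') = (x + x⁻¹) ^ 2 := by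
        rw [← sub_eq_zero.mp h2]
        linear_combination (-(y + z) ^ 2) * hx'
      rw [hκi, hκ]
      have h4 : (x + x⁻¹) ^ 2 = x ^ 2 + (x ^ 2)⁻¹ + 2 := by field_simp; ring
      rw [h4] at h3
      linear_combination h3 - 4 * x' * hyz + 4 * hx'
    have hκ4 : κ ^ (4 * m) = -1 := by
      rw [hκ, mul_pow, pow_mul, hx4, ← pow_mul, show 2 * (4 * m) = 8 * m by ring, hA.cy]
      simp
    have hκ8 : κ ^ (2 * (4 * m)) = 1 := by rw [mul_comm, pow_mul, hκ4]; norm_num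
    have hx28 : (x ^ 2) ^ (4 * m) = -1 := by
      rw [← pow_mul, show 2 * (4 * m) = 8 * m by ring, hx]
    have hx216 : (x ^ 2) ^ (2 * (4 * m)) = 1 := by rw [mul_comm, pow_mul, hx28]; norm_num
    -- At the lower level `4 * m` all of `κ`, `κ⁻¹`, `x²`, `x⁻²` lie in the class `-1`, so the
    -- trivial class reads `2 = 0`.
    obtain ⟨C', s', hC', -, hsp'⟩ := exists_classSum_sub_eq (A := {1, 1, κ, κ, κ⁻¹, κ⁻¹})
      (B := {x ^ 2, (x ^ 2)⁻¹}) Nat.prime_two (by omega : 0 < 4 * m) (by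
        intro t ht
        simp only [Multiset.insert_eq_cons, Multiset.mem_cons, Multiset.mem_singleton] at ht
        rcases ht with rfl | rfl | rfl | rfl | rfl | rfl <;> simp [hκ8]) (by
        intro t ht
        simp only [Multiset.insert_eq_cons, Multiset.mem_cons, Multiset.mem_singleton] at ht
        rcases ht with rfl | rfl
        · exact hx216
        · rw [inv_pow, hx216, inv_one]) (by
        simp only [Multiset.insert_eq_cons, Multiset.sum_cons, Multiset.sum_singleton]
        linear_combination hsum)
    rw [hC' ⟨2 * m, by ring⟩] at hsp'
    have h5 := hsp' 1 (by norm_num)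
    simp only [classSum, Multiset.insert_eq_cons, Multiset.map_cons, Multiset.map_singleton,
      Multiset.sum_cons, Multiset.sum_singleton, one_pow, inv_pow _ (4 * m), hκ4, hx28] at h5
    norm_num at h5

namespace ClassDisjoint

/-- The class `-1` gives `(v + w)(1 + u) = 0`, so `w = -v` and `u = -v⁻²`, and the sum collapses to
`u + u⁻¹` with `u ^ (M / 2) = -1`; `sum_ne_of_two_adic` excludes this. -/
theorem two_trivial_typeL (h : ClassDisjoint 2 M A B) (hM0 : 0 < M) (hM : 16 ∣ M)
    (hs : A.sum = B.sum) (h0 : IsTriple (2 * M) A x y z) (hA : ∀ t ∈ A, t ^ M = 1)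
    (hB : IsTypeL 2 M B u v w (-1)) : False := by
  have h1 := h.classSum_eq (-1) (by norm_num)
  rw [hB.classSum_neg_one_two, classSum_eq_zero fun t ht => by rw [hA t ht]; norm_num] at h1
  rcases mul_eq_zero.mp h1.symm with h2 | h2
  · have hw : w = -v := by linear_combination h2
    have hu : u = -(v ^ 2)⁻¹ := by
      have hv := hB.y_ne_zero
      have := hB.prod
      rw [hw] at this
      field_simp
      linear_combination -this
    have hu' : u ^ (M / 2) = -1 := by
      obtain ⟨m, rfl⟩ := hM
      rw [show 16 * m / 2 = 8 * m by omega, hu, Even.neg_pow ⟨4 * m, by ring⟩, inv_pow, ← pow_mul,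
        show 2 * (8 * m) = 16 * m by ring, hB.cy]
      norm_num
    refine sum_ne_of_two_adic hM hM0 (h0.restrict hA) hu' ?_
    rw [hs, hB.sum_eq, hw, hu]
    have hv := hB.y_ne_zero
    field_simp
    ring
  · exact h.right ((show u = -1 by linear_combination h2) ▸ hB.x_mem)

theorem pow_eq_one_of_two (h : ClassDisjoint 2 M A B) (hM0 : 0 < M) (hM : 16 ∣ M)
    (hs : A.sum = B.sum) (hA : IsTriple (2 * M) A x y z) (hB : IsTriple (2 * M) B u v w) :
    (∀ t ∈ A, t ^ M = 1) ∧ ∀ t ∈ B, t ^ M = 1 := by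
  rcases hA.types_two with hA' | ⟨_, _, _, hA'⟩ <;>
    rcases hB.types_two with hB' | ⟨_, _, _, hB'⟩
  · exact ⟨hA', hB'⟩
  · exact (h.two_trivial_typeL hM0 hM hs hA hA' hB').elim
  · exact (h.symm.two_trivial_typeL hM0 hM hs.symm hB hB' hA').elim
  · have := h.classSum_eq 1 (one_pow _)
    rw [hA'.classSum_one_two, hB'.classSum_one_two] at this
    rcases eq_or_eq_inv_of_add_inv_eq hA'.x_ne_zero hB'.x_ne_zero this with h1 | h1
    · exact (h.disj _ hA'.x_mem (h1 ▸ hB'.x_mem)).elim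
    · exact (h.disj _ hA'.x_mem (h1 ▸ hB'.x_inv_mem)).elim

end ClassDisjoint

end

/-! ### Relations that do not split: the bound on `p` and the prime seven. -/

section

/-- The classes of `A` and `B` modulo the `M`-th roots of unity differ by a fixed nonzero multiple
of the sum of the `p`-th roots of unity, where `p ∤ M`. -/
structure ClassShift (p M s : ℕ) (C : ℂ) (A B : Multiset ℂ) : Prop where
  classSum_sub : ∀ ε : ℂ, ε ^ p = 1 → classSum M ε A - classSum M ε B = C * ε⁻¹ ^ s
  ne_zero : C ≠ 0
  dvd : p ∣ 1 + M * s

variable {p M s : ℕ} {A B : Multiset ℂ} {x y z u v w a b C : ℂ}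

theorem IsPrimitiveRoot.le_card_of_forall_mem {ζ : ℂ} (hζ : IsPrimitiveRoot ζ p) {S : Finset ℂ}
    (h : ∀ ε : ℂ, ε ^ p = 1 → ε ∈ S) : p ≤ S.card := by
  have hc : ((Finset.range p).image (ζ ^ ·)).card = p := by
    rw [Finset.card_image_of_injOn, Finset.card_range]
    intro i hi j hj hij
    exact hζ.pow_inj (by simpa using hi) (by simpa using hj) hij
  rw [← hc]
  refine Finset.card_le_card fun ε hε => ?_
  obtain ⟨i, -, rfl⟩ := Finset.mem_image.mp hε
  exact h _ (by rw [← pow_mul, mul_comm, pow_mul, hζ.pow_eq_one, one_pow])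

/-- The six classes of the triple and its inverses are distinct, hence are all the nontrivial ones.
Concretely the classes are `σ`, `σ²`, `σ⁴` up to order. -/
theorem IsTypeG.forall_mem_seven (h : IsTypeG 7 M A x y z) :
    (∀ ε : ℂ, ε ^ 7 = 1 → ε ≠ 1 → ∃ t ∈ A, t ^ M = ε) := by
  intro ε hε hε1
  have ha : IsPrimitiveRoot (x ^ M) 7 :=
    isPrimitiveRoot_of_pow_prime (by norm_num) (by rw [← pow_mul, mul_comm, h.hx]) h.cx
  set σ := x ^ M with hσ
  have h7 := ha.pow_eq_one
  obtain ⟨k, hk, hyk⟩ := ha.eq_pow_of_pow_eq_one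
    (show (y ^ M) ^ 7 = 1 by rw [← pow_mul, mul_comm, h.hy])
  obtain ⟨j, hj, rfl⟩ := ha.eq_pow_of_pow_eq_one hε
  -- The exponent is `-1 - k` modulo `7`, shifted by `14` to stay natural.
  have hz : z ^ M = σ ^ (13 - k) := by
    have h1 := h.mul_pow_eq_one
    rw [← hyk, ← hσ] at h1
    have h2 : σ * σ ^ k * σ ^ (13 - k) = 1 := by
      rw [← pow_succ', ← pow_add, show k + 1 + (13 - k) = 7 * 2 by omega, pow_mul, h7, one_pow]
    have h3 : σ * σ ^ k ≠ 0 := left_ne_zero_of_mul_eq_one h2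
    exact mul_left_cancel₀ h3 (h1.trans h2.symm)
  have cx := h.cx
  have cy := h.cy
  have cz := h.cz
  have cxy := h.cxy
  have cyz := h.cyz
  have czx := h.czx
  rw [← hσ] at cxy czx
  rw [← hyk] at cy cxy cyz
  rw [hz] at cz cyz czx
  have red : ∀ n, σ ^ (n + 7) = σ ^ n := fun n => by rw [pow_add, h7, mul_one]
  have inv : ∀ {t : ℂ} {m n : ℕ}, t ^ M = σ ^ m → m + n = 7 → (t⁻¹) ^ M = σ ^ n := by
    intro t m n h1 h2
    rw [inv_pow, h1]
    exact inv_eq_of_mul_eq_one_right (by rw [← pow_add, h2, h7])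
  have hx1 : x ^ M = σ ^ 1 := by rw [pow_one]
  have m1 : ∃ t ∈ A, t ^ M = σ ^ 1 := ⟨x, h.x_mem, hx1⟩
  have m6 : ∃ t ∈ A, t ^ M = σ ^ 6 := ⟨x⁻¹, h.x_inv_mem, inv hx1 rfl⟩
  have fin : ∀ {y z : ℂ}, y ∈ A → z ∈ A → y⁻¹ ∈ A → z⁻¹ ∈ A → y ^ M = σ ^ 2 → z ^ M = σ ^ 4 →
      ∃ t ∈ A, t ^ M = σ ^ j := by
    intro y z y1 z1 y2 z2 hy hz
    interval_cases j
    · exact absurd (pow_zero σ) hε1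
    · exact m1
    · exact ⟨y, y1, hy⟩
    · exact ⟨z⁻¹, z2, inv hz rfl⟩
    · exact ⟨z, z1, hz⟩
    · exact ⟨y⁻¹, y2, inv hy rfl⟩
    · exact m6
  interval_cases k
  · exact absurd (pow_zero σ) cy
  · exact absurd (pow_one σ).symm cxy
  · exact fin h.y_mem h.z_mem h.y_inv_mem h.z_inv_mem hyk.symm (by rw [hz]; exact red 4)
  · exact absurd (red 3).symm cyz
  · exact fin h.z_mem h.y_mem h.z_inv_mem h.y_inv_mem (by rw [hz]; exact red 2) hyk.symm
  · exact absurd ((red 1).trans (pow_one σ)) czx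
  · exact absurd h7 cz

/-- For an element isolated in its class, multiply the relations in that class and in the inverse
class. -/
theorem sq_eq_one_of_neg_eq {t τ : ℂ} (ht : t ≠ 0) (hτ : τ ≠ 0) (h : -t = C * τ)
    (h' : -t⁻¹ = C * τ⁻¹) : C ^ 2 = 1 := by
  have : (-t) * (-t⁻¹) = (C * τ) * (C * τ⁻¹) := by rw [h, h']
  rw [neg_mul_neg, mul_inv_cancel₀ ht] at this
  linear_combination -this - C ^ 2 * mul_inv_cancel₀ hτ

namespace ClassShift

theorem symm (h : ClassShift p M s C A B) : ClassShift p M s (-C) B A :=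
  ⟨fun ε hε => by linear_combination -h.classSum_sub ε hε, neg_ne_zero.mpr h.ne_zero, h.dvd⟩

theorem cover (h : ClassShift p M s C A B) (hp : p ≠ 0) {ε : ℂ} (hε : ε ^ p = 1) :
    classSum M ε A ≠ 0 ∨ classSum M ε B ≠ 0 := by
  by_contra! h'
  have := h.classSum_sub ε hε
  rw [h'.1, h'.2, sub_zero] at this
  have hε0 : ε ≠ 0 := by
    rintro rfl
    simp [hp] at hε
  exact mul_ne_zero h.ne_zero (pow_ne_zero _ (inv_ne_zero hε0)) this.symm

/-- Every class is occupied. The multiset occupying the trivial class has a member there, so it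
meets at most three classes, and the other meets at most six. -/
theorem le_nine (h : ClassShift p M s C A B) (hp : p.Prime) (hA : IsTriple (p * M) A x y z)
    (hB : IsTriple (p * M) B u v w) : p ≤ 9 := by
  wlog hA1 : classSum M 1 A ≠ 0 generalizing A B C x y z u v w
  · exact this h.symm hB hA ((h.cover hp.ne_zero (one_pow _)).resolve_left hA1)
  obtain ⟨t, ht, ht1⟩ := exists_mem_of_classSum_ne_zero hA1
  obtain ⟨y, z, hA⟩ := hA.exists_of_mem ht
  have hyz : y ^ M * z ^ M = 1 := by
    have := congrArg (· ^ M) hA.prod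
    simpa only [mul_pow, ht1, one_mul, one_pow] using this
  have hζ := Complex.isPrimitiveRoot_exp p hp.ne_zero
  refine (hζ.le_card_of_forall_mem (S := {1, y ^ M, (y ^ M)⁻¹, u ^ M, v ^ M, w ^ M, (u ^ M)⁻¹,
    (v ^ M)⁻¹, (w ^ M)⁻¹}) fun ε hε => ?_).trans ?_
  swap
  · refine (Finset.card_insert_le _ _).trans (Nat.succ_le_succ ?_)
    refine (Finset.card_insert_le _ _).trans (Nat.succ_le_succ ?_)
    exact (Finset.card_insert_le _ _).trans (Nat.succ_le_succ Finset.card_le_six)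
  rcases h.cover hp.ne_zero hε with h1 | h1
  · obtain ⟨c, hc, rfl⟩ := exists_mem_of_classSum_ne_zero h1
    rw [hA.eq, mem_invMultiset] at hc
    have hz : z ^ M = (y ^ M)⁻¹ := eq_inv_of_mul_eq_one_right hyz
    rcases hc with rfl | rfl | rfl | rfl | rfl | rfl <;> simp [ht1, hz]
  · obtain ⟨c, hc, rfl⟩ := exists_mem_of_classSum_ne_zero h1
    rw [hB.eq, mem_invMultiset] at hc
    rcases hc with rfl | rfl | rfl | rfl | rfl | rfl <;> simp

theorem pow_inv_pow_eq_one {p s : ℕ} {ε : ℂ} (hε : ε ^ p = 1) : (ε⁻¹ ^ s) ^ p = 1 := by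
  rw [← pow_mul, mul_comm, pow_mul, inv_pow, hε, inv_one, one_pow]

theorem isPrimitiveRoot (h : ClassShift p M s C A B) (hp : p.Prime) (ha : IsPrimitiveRoot a p) :
    IsPrimitiveRoot (a⁻¹ ^ s) p := by
  refine ha.inv.pow_of_coprime s ?_
  rw [Nat.coprime_comm, hp.coprime_iff_not_dvd]
  intro hd
  have := (Nat.dvd_add_left (hd.mul_left M)).mp h.dvd
  exact hp.one_lt.ne' (Nat.dvd_one.mp this)

/-- If all of `A` is in the trivial class, then `B` consists of the primitive seventh roots of
unity. -/
theorem seven_trivial_typeG (h : ClassShift 7 M s C A B) (hA : ∀ t ∈ A, t ^ M = 1)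
    (hB : IsTypeG 7 M B u v w) :
    A.sum = -1 ∧ ∃ σ, IsPrimitiveRoot σ 7 ∧ B = invMultiset σ (σ ^ 2) (σ ^ 4) := by
  have hp : Nat.Prime 7 := by norm_num
  have hu : ∀ {t y z : ℂ}, IsTypeG 7 M B t y z → -t = C * ((t ^ M)⁻¹) ^ s := by
    intro t y z hB
    have := h.classSum_sub (t ^ M) (by rw [← pow_mul, mul_comm, hB.hx])
    rw [hB.classSum_x hp (by norm_num), classSum_eq_zero fun t' ht' => by
      rw [hA t' ht']; exact hB.cx.symm, zero_sub] at this
    exact this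
  have e1 := hu hB
  have e2 := hu hB.inv
  have e3 := hu hB.rotate
  have e4 := hu hB.rotate.rotate
  have u0 := hB.x_ne_zero
  have hC2 : C ^ 2 = 1 := by
    refine sq_eq_one_of_neg_eq u0 (pow_ne_zero s (inv_ne_zero (pow_ne_zero M u0))) e1 ?_
    rw [e2]
    simp only [inv_pow, inv_inv]
  -- Multiplying the relations of the three isolated elements gives `C³ = -1`.
  have hC : C = -1 := by
    have h1 : -(u * v * w) = C ^ 3 * ((u ^ M * v ^ M * w ^ M)⁻¹) ^ s := by
      rw [mul_inv, mul_inv, mul_pow, mul_pow]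
      linear_combination (v * w) * e1 - w * (C * (u ^ M)⁻¹ ^ s) * e3
        + (C * (u ^ M)⁻¹ ^ s) * (C * (v ^ M)⁻¹ ^ s) * e4
    rw [hB.mul_pow_eq_one, hB.prod, inv_one, one_pow] at h1
    linear_combination -h1 - C * hC2
  subst hC
  have hr : ∀ {t y z : ℂ}, IsTypeG 7 M B t y z → t ^ 7 = 1 := by
    intro t y z hB
    have h1 := hu hB
    rw [neg_one_mul, neg_inj] at h1
    rw [h1]
    exact pow_inv_pow_eq_one (by rw [← pow_mul, mul_comm, hB.hx])
  refine ⟨?_, ?_⟩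
  · have := h.classSum_sub 1 (one_pow _)
    have hB1 : classSum M 1 B = 0 := by
      rw [hB.eq, classSum_invMultiset]
      simp [hB.cx, hB.cy, hB.cz]
    rw [classSum_of_trivial hA, hB1] at this
    simpa using this
  · have u7 := hr hB
    have v7 := hr hB.rotate
    have ne : ∀ {c d : ℂ}, c ^ M ≠ d ^ M → c ≠ d := fun h1 h2 => h1 (h2 ▸ rfl)
    have cx : u ≠ 1 := ne (by rw [one_pow]; exact hB.cx)
    have cy : v ≠ 1 := ne (by rw [one_pow]; exact hB.cy)
    have cz : w ≠ 1 := ne (by rw [one_pow]; exact hB.cz)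
    have cxy := ne hB.cxy
    have cyz := ne hB.cyz
    have czx := ne hB.czx
    have hσ := isPrimitiveRoot_of_pow_prime hp u7 cx
    refine ⟨u, hσ, ?_⟩
    obtain ⟨k, hk, hvk⟩ := hσ.eq_pow_of_pow_eq_one v7
    have hw : w = u ^ (13 - k) := by
      have h1 := hB.prod
      rw [← hvk] at h1
      have h2 : u * u ^ k * u ^ (13 - k) = 1 := by
        rw [← pow_succ', ← pow_add, show k + 1 + (13 - k) = 7 * 2 by omega, pow_mul, u7, one_pow]
      exact mul_left_cancel₀ (left_ne_zero_of_mul_eq_one h2) (h1.trans h2.symm)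
    have red : ∀ n, u ^ (n + 7) = u ^ n := fun n => by rw [pow_add, u7, mul_one]
    rw [← hvk] at cy cxy cyz
    rw [hw] at cz cyz czx
    have hBeq := hB.eq
    rw [← hvk, hw] at hBeq
    interval_cases k
    · exact absurd (pow_zero u) cy
    · exact absurd (pow_one u).symm cxy
    · rw [hBeq]; congr 1; exact red 4
    · exact absurd (red 3).symm cyz
    · rw [hBeq, invMultiset_rotate, invMultiset_swap, invMultiset_rotate, invMultiset_rotate]
      congr 1; exact red 2
    · exact absurd ((red 1).trans (pow_one u)) czx
    · exact absurd u7 cz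

/-- The isolated elements outside the classes `a`, `a⁻¹` give `C² = 1`, and the product condition
makes the one in class `a` equal to `a⁻¹ ^ s`. Then `(y + z⁻¹)(z + y⁻¹)` is both `2 + x + x⁻¹ = 2 +
C` and `(1 + C)² = 2 + 2C`, so `C = 0`. -/
theorem seven_typeL_typeG (h : ClassShift 7 M s C A B) (hA : IsTypeL 7 M A x y z a)
    (hB : IsTypeG 7 M B u v w) : False := by
  have hp : Nat.Prime 7 := by norm_num
  have hp3 : 3 ≤ 7 := by norm_num
  obtain ⟨t, ht, hta⟩ := hB.forall_mem_seven a hA.prim.pow_eq_one (hA.ne_one hp3)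
  obtain ⟨v, w, hB⟩ := hB.exists_of_mem ht
  set τ : ℂ → ℂ := fun ε => ε⁻¹ ^ s with hτ
  have τinv : ∀ ε, τ ε⁻¹ = (τ ε)⁻¹ := fun ε => by simp [hτ]
  have τne : ∀ {ε}, ε ≠ 0 → τ ε ≠ 0 := fun h => pow_ne_zero s (inv_ne_zero h)
  have single : ∀ {c y z : ℂ}, IsTypeG 7 M B c y z → c ^ M ≠ a → c ^ M ≠ a⁻¹ →
      -c = C * τ (c ^ M) := by
    intro c y z hB h1 h2
    have := h.classSum_sub (c ^ M) (by rw [← pow_mul, mul_comm, hB.hx])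
    rwa [hB.classSum_x hp hp3, hA.classSum_other hB.cx h1 h2, zero_sub] at this
  have v0 := hB.y_ne_zero
  have w0 := hB.z_ne_zero
  have n1 := hB.inv_ne_y
  have n2 := hB.rotate.rotate.inv_ne_y
  have n3 := hB.cxy
  have n4 := hB.czx
  rw [hta] at n1 n3 n4
  have n5 : (w ^ M) ≠ a⁻¹ := by
    intro h1
    rw [h1, hta, inv_inv] at n2
    exact n2 rfl
  have e1 := single hB.rotate n3.symm n1.symm
  have e2 := single hB.rotate.inv (by rw [inv_pow]; exact fun h1 => n1 (by rw [← h1, inv_inv]))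
    (by rw [inv_pow]; exact fun h1 => n3 (inv_injective h1).symm)
  have e3 := single hB.rotate.rotate n4 n5
  have hC2 : C ^ 2 = 1 := by
    refine sq_eq_one_of_neg_eq v0 (τne (pow_ne_zero M v0)) e1 ?_
    rw [e2, inv_pow, τinv]
  have a0 : a ≠ 0 := hA.prim.ne_zero (by norm_num)
  have ht' : t = τ a := by
    have h1 : v * w * τ a = 1 := by
      have h2 : τ a * τ (v ^ M) * τ (w ^ M) = 1 := by
        simp only [hτ]
        rw [← mul_pow, ← mul_pow, ← mul_inv, ← mul_inv, ← hta, hB.mul_pow_eq_one]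
        simp
      linear_combination (-w * τ a) * e1 + (C * τ (v ^ M) * τ a) * e3
        + C ^ 2 * h2 + hC2
    have h3 := hB.prod
    have h4 : v * w ≠ 0 := mul_ne_zero v0 w0
    apply mul_right_cancel₀ h4
    linear_combination h3 - h1
  have h1 := h.classSum_sub a hA.prim.pow_eq_one
  have h2 := h.classSum_sub a⁻¹ (by simp [hA.prim.pow_eq_one])
  have h3 := h.classSum_sub 1 (one_pow _)
  have hB1 : classSum M 1 B = 0 := by
    rw [hB.eq, classSum_invMultiset]
    simp [hB.cx, hB.cy, hB.cz]
  rw [hA.classSum_one hp3, hB1] at h3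
  have k1 := hB.classSum_x hp hp3
  have k2 := hB.inv.classSum_x hp hp3
  rw [hta] at k1
  rw [inv_pow, hta] at k2
  rw [hA.classSum_self hp3, k1, ht'] at h1
  rw [hA.classSum_inv hp3, k2, ht'] at h2
  change _ = C * τ a at h1
  change _ = C * τ a⁻¹ at h2
  rw [τinv] at h2
  simp only [inv_one, one_pow, mul_one, sub_zero] at h3
  have hτa := mul_inv_cancel₀ (τne a0)
  have y0 := hA.y_ne_zero
  have z0 := hA.z_ne_zero
  have hx1 : x⁻¹ = y * z := by
    have := hA.x_ne_zero
    field_simp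
    linear_combination -hA.prod
  have hx2 : (y * z)⁻¹ = x := by rw [← hx1, inv_inv]
  have key : (y + z⁻¹) * (z + y⁻¹) = 2 + C := by
    rw [show (y + z⁻¹) * (z + y⁻¹) = 2 + y * z + (y * z)⁻¹ by field_simp; ring, hx2, ← hx1]
    linear_combination h3
  have key2 : (y + z⁻¹) * (z + y⁻¹) = (1 + C) ^ 2 := by
    rw [show y + z⁻¹ = (1 + C) * τ a by linear_combination h1,
      show z + y⁻¹ = (1 + C) * (τ a)⁻¹ by linear_combination h2]
    linear_combination (1 + C) ^ 2 * hτa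
  have hC0 : C = 0 := by linear_combination key - key2 - hC2
  exact h.ne_zero hC0

/-- If `A` and `B` have three and four classes, the relation comes from a primitive seventh and a
primitive third root of unity. -/
theorem seven_typeL_typeD (h : ClassShift 7 M s C A B) (hA : IsTypeL 7 M A x y z a)
    (hB : IsTypeD 7 M B u v w b) :
    ∃ σ ω, IsPrimitiveRoot σ 7 ∧ IsPrimitiveRoot ω 3 ∧
      A = invMultiset ω (σ ^ 3 * ω) ((σ ^ 3)⁻¹ * ω) ∧
      B = invMultiset (-(σ * ω)) (-(σ * ω ^ 2)) (σ⁻¹ ^ 2) := by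
  have hp : Nat.Prime 7 := by norm_num
  have hp3 : 3 ≤ 7 := by norm_num
  have hp5 : 5 ≤ 7 := by norm_num
  have b7 := hB.prim.pow_eq_one
  have b0 : b ≠ 0 := hB.prim.ne_zero (by norm_num)
  have ne : ∀ k, 0 < k → k < 7 → b ^ k ≠ 1 := fun k hk hk' =>
    hB.prim.pow_ne_one_of_pos_of_lt hk.ne' hk'
  -- `B` occupies only `b^{±1}` and `b^{±2}`, so `A` must cover `b^{±3}`; this determines `a` up to
  -- inversion.
  have hB3 : classSum M (b ^ 3) B = 0 := by
    apply hB.classSum_other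
    · exact fun e => ne 2 (by omega) (by omega) (mul_left_cancel₀ b0 (by linear_combination e))
    · exact fun e => ne 4 (by omega) (by omega)
        (by linear_combination b * e + mul_inv_cancel₀ b0)
    · exact fun e => ne 5 (by omega) (by omega)
        (by linear_combination b ^ 2 * e + mul_inv_cancel₀ (pow_ne_zero 2 b0))
    · exact fun e => ne 1 (by omega) (by omega)
        (mul_left_cancel₀ (pow_ne_zero 2 b0) (by linear_combination e))
  have b37 : (b ^ 3) ^ 7 = 1 := by rw [← pow_mul, mul_comm, pow_mul, b7, one_pow]
  have hA3 := (h.cover (by norm_num) b37).resolve_right (by simpa using hB3)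
  wlog hab : a = b ^ 3 generalizing x y z a
  · refine this hA.inv ?_
    rcases hA.eq_of_classSum_ne_zero hA3 with e | e | e
    · exact absurd e (ne 3 (by omega) (by omega))
    · exact absurd e.symm hab
    · exact e.symm
  set T := b⁻¹ ^ s with hT
  have hTp := h.isPrimitiveRoot hp hB.prim
  rw [← hT] at hTp
  have T0 : T ≠ 0 := hTp.ne_zero (by norm_num)
  have u0 := hB.x_ne_zero
  have v0 := hB.y_ne_zero
  have w0 := hB.z_ne_zero
  have nA : ∀ k, 0 < k → k < 3 → classSum M (b ^ k) A = 0 := by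
    intro k hk hk'
    apply hA.classSum_other (ne k hk (by omega))
    · intro e
      rw [hab] at e
      refine ne (3 - k) (by omega) (by omega) (mul_left_cancel₀ (pow_ne_zero k b0) ?_)
      rw [← pow_add, show k + (3 - k) = 3 by omega, mul_one, e]
    · intro e
      rw [hab] at e
      refine ne (k + 3) (by omega) (by omega) ?_
      rw [pow_add, e, inv_mul_cancel₀ (pow_ne_zero 3 b0)]
  have nA' : ∀ k, 0 < k → k < 3 → classSum M (b ^ k)⁻¹ A = 0 := by
    intro k hk hk'
    apply hA.classSum_other (inv_ne_one.mpr (ne k hk (by omega)))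
    · intro e
      rw [hab] at e
      refine ne (k + 3) (by omega) (by omega) ?_
      rw [pow_add, ← e, mul_inv_cancel₀ (pow_ne_zero k b0)]
    · intro e
      rw [hab] at e
      refine ne (3 - k) (by omega) (by omega) (mul_left_cancel₀ (pow_ne_zero k b0) ?_)
      rw [← pow_add, show k + (3 - k) = 3 by omega, mul_one, inv_injective e]
  have bk : ∀ k, (b ^ k) ^ 7 = 1 := fun k => by rw [← pow_mul, mul_comm, pow_mul, b7, one_pow]
  have bk' : ∀ k, ((b ^ k)⁻¹) ^ 7 = 1 := fun k => by rw [inv_pow, bk, inv_one]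
  have τk : ∀ k, (b ^ k)⁻¹ ^ s = T ^ k := fun k => by
    rw [hT, ← inv_pow, ← pow_mul, ← pow_mul, mul_comm]
  have τk' : ∀ k, (b ^ k)⁻¹⁻¹ ^ s = (T ^ k)⁻¹ := fun k => by
    rw [← τk]
    simp only [inv_pow, inv_inv]
  have f1 := h.classSum_sub (b ^ 1) (bk 1)
  have f2 := h.classSum_sub (b ^ 1)⁻¹ (bk' 1)
  have f3 := h.classSum_sub (b ^ 2) (bk 2)
  have f4 := h.classSum_sub (b ^ 2)⁻¹ (bk' 2)
  have f5 := h.classSum_sub 1 (one_pow _)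
  have f6 := h.classSum_sub (b ^ 3) (bk 3)
  rw [nA 1 (by omega) (by omega), τk, pow_one, hB.classSum_self hp5] at f1
  rw [nA' 1 (by omega) (by omega), τk', pow_one, hB.inv.classSum_self hp5] at f2
  have k1 := hB.inv.classSum_sq_inv hp5
  rw [inv_pow, inv_inv] at k1
  rw [nA 2 (by omega) (by omega), τk, k1] at f3
  rw [nA' 2 (by omega) (by omega), τk', hB.classSum_sq_inv hp5] at f4
  rw [hA.classSum_one hp3, hB.classSum_one hp5] at f5
  rw [hB3, τk, ← hab, hA.classSum_self hp3] at f6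
  simp only [inv_one, one_pow, mul_one, sub_zero, pow_one, zero_sub] at f1 f2 f3 f4 f5 f6
  have hC2 : C ^ 2 = 1 := sq_eq_one_of_neg_eq w0 (inv_ne_zero (pow_ne_zero 2 T0)) f4
    (by rw [inv_inv]; exact f3)
  have huv : u * v = w⁻¹ := by
    field_simp
    linear_combination hB.prod
  -- Compare `u⁻¹ + v⁻¹ = -C * T⁻¹` with `(u + v)w = C² * T⁻¹`.
  have hC : C = -1 := by
    have g1 : u⁻¹ + v⁻¹ = (u + v) * w := by
      have : u⁻¹ + v⁻¹ = (u + v) * (u * v)⁻¹ := by field_simp; ring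
      rw [this, huv, inv_inv]
    have g2 : -(u⁻¹ + v⁻¹) = -(C ^ 2 * T⁻¹) := by
      rw [g1]
      have : (u + v) * w = (C * T) * (C * (T ^ 2)⁻¹) := by
        rw [← f1, ← f4]; ring
      rw [this]
      field_simp
    have g3 : C * T⁻¹ = -1 * T⁻¹ := by
      rw [← f2, g2, hC2]; ring
    exact mul_right_cancel₀ (inv_ne_zero T0) g3
  subst hC
  have hw : w = (T ^ 2)⁻¹ := by linear_combination -f4
  have hsum : u + v = T := by linear_combination -f1
  rw [hw, inv_inv] at huv
  have x0 := hA.x_ne_zero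
  have hxq : x ^ 2 + x + 1 = 0 := by linear_combination x * f5 - mul_inv_cancel₀ x0
  have hx3 : x ^ 3 = 1 := by linear_combination (x - 1) * hxq
  have hx1 : x ≠ 1 := by
    rintro rfl
    norm_num at hxq
  have y0 := hA.y_ne_zero
  have z0 := hA.z_ne_zero
  have hzi : z⁻¹ = x * y := by field_simp; linear_combination -hA.prod
  have hy : y = T ^ 3 * x := by
    rw [hzi] at f6
    linear_combination -x * f6 + y * hxq
  have hz : z = (T ^ 3)⁻¹ * x := by
    rw [← inv_inv z, hzi, hy]
    field_simp
    linear_combination -hx3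
  refine ⟨T, x, hTp, isPrimitiveRoot_of_pow_prime Nat.prime_three hx3 hx1, ?_, ?_⟩
  · rw [hA.eq, ← hy, ← hz]
  -- From `u + v = T` and `uv = T²`, the quotients `u / T` and `v / T` are `-x` and `-x²`.
  · have hq : (u + T * x) * (u + T * x ^ 2) = 0 := by
      linear_combination u * hsum - huv + u * T * hxq + T ^ 2 * hx3
    rw [hB.eq, inv_pow, ← hw]
    rcases mul_eq_zero.mp hq with e | e
    · rw [show u = -(T * x) by linear_combination e,
        show v = -(T * x ^ 2) by linear_combination hsum - e + T * hxq]
    · rw [show u = -(T * x ^ 2) by linear_combination e,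
        show v = -(T * x) by linear_combination hsum - e + T * hxq, invMultiset_swap]

/-- A relation with `p = 7` not splitting into relations between the classes. -/
theorem seven (h : ClassShift 7 M s C A B) (hA : IsTriple (7 * M) A x y z)
    (hB : IsTriple (7 * M) B u v w) (hA1 : classSum M 1 A ≠ 0) :
    ((∀ t ∈ A, t ^ M = 1) ∧ A.sum = -1 ∧
      ∃ σ, IsPrimitiveRoot σ 7 ∧ B = invMultiset σ (σ ^ 2) (σ ^ 4)) ∨
    ∃ σ ω, IsPrimitiveRoot σ 7 ∧ IsPrimitiveRoot ω 3 ∧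
      A = invMultiset ω (σ ^ 3 * ω) ((σ ^ 3)⁻¹ * ω) ∧
      B = invMultiset (-(σ * ω)) (-(σ * ω ^ 2)) (σ⁻¹ ^ 2) := by
  have hp : Nat.Prime 7 := by norm_num
  have hζ := Complex.isPrimitiveRoot_exp 7 (by norm_num)
  -- All seven classes must be covered. Trivial, L, D, G occupy at most 1, 3, 4, 6 classes, and D
  -- and G miss the trivial one.
  have small : ∀ {S : Finset ℂ}, S.card ≤ 5 → (∀ ε, classSum M ε A ≠ 0 → ε ∈ S) →
      (∀ ε, classSum M ε B ≠ 0 → ε ∈ S) → False := by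
    intro S hS h1 h2
    have := hζ.le_card_of_forall_mem (S := S) fun ε hε =>
      (h.cover (by norm_num) hε).elim (h1 ε) (h2 ε)
    omega
  have triv : ∀ {A : Multiset ℂ}, (∀ t ∈ A, t ^ M = 1) → ∀ ε, classSum M ε A ≠ 0 → ε = 1 := by
    intro A hA ε hε
    obtain ⟨t, ht, rfl⟩ := exists_mem_of_classSum_ne_zero hε
    exact hA t ht
  rcases hA.types hp with hA | ⟨_, _, _, a, hA⟩ | ⟨_, _, _, a, hA⟩ | ⟨_, _, _, hA⟩
  · rcases hB.types hp with hB | ⟨_, _, _, b, hB⟩ | ⟨_, _, _, b, hB⟩ | ⟨_, _, _, hB⟩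
    · refine (small (S := {1}) (by simp) ?_ ?_).elim
      · simpa using triv hA
      · simpa using triv hB
    · refine (small (S := {1, b, b⁻¹}) (Finset.card_le_three.trans (by norm_num)) ?_ ?_).elim
      · intro ε hε
        simp [triv hA ε hε]
      · intro ε hε
        rcases hB.eq_of_classSum_ne_zero hε with e | e | e <;> simp [e]
    · refine (small (S := {1, b, b⁻¹, (b ^ 2)⁻¹, b ^ 2}) Finset.card_le_five ?_ ?_).elim
      · intro ε hε
        simp [triv hA ε hε]
      · intro ε hε
        rcases hB.eq_of_classSum_ne_zero hε with e | e | e | e <;> simp [e]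
    · exact Or.inl ⟨hA, h.seven_trivial_typeG hA hB⟩
  · rcases hB.types hp with hB | ⟨_, _, _, b, hB⟩ | ⟨_, _, _, b, hB⟩ | ⟨_, _, _, hB⟩
    · refine (small (S := {1, a, a⁻¹}) (Finset.card_le_three.trans (by norm_num)) ?_ ?_).elim
      · intro ε hε
        rcases hA.eq_of_classSum_ne_zero hε with e | e | e <;> simp [e]
      · intro ε hε
        simp [triv hB ε hε]
    · refine (small (S := {1, a, a⁻¹, b, b⁻¹}) Finset.card_le_five ?_ ?_).elim
      · intro ε hε
        rcases hA.eq_of_classSum_ne_zero hε with e | e | e <;> simp [e]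
      · intro ε hε
        rcases hB.eq_of_classSum_ne_zero hε with e | e | e <;> simp [e]
    · exact Or.inr (h.seven_typeL_typeD hA hB)
    · exact (h.seven_typeL_typeG hA hB).elim
  · exact absurd (hA.classSum_one (by norm_num)) hA1
  · refine absurd ?_ hA1
    rw [hA.eq, classSum_invMultiset]
    simp [hA.cx, hA.cy, hA.cz]

end ClassShift

end

/-! ### The finite computation on traces of triples of 240th roots of unity. -/

/-- The residue of the trace with exponents `±a, ±b, ±c` modulo `240` in a prime field containing a primitive `240`-th root of unity. -/
def residueTrace (a b c : ℕ) : ℕ :=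
  (3524605 ^ a + 3524605 ^ b + 3524605 ^ c + 3524605 ^ (240 - a) + 3524605 ^ (240 - b)
    + 3524605 ^ (240 - c)) % 4194961

/-- The third exponent of a reduced triple, given the two smaller ones. -/
def thirdExponent (a b : ℕ) : ℕ := bif Nat.ble (a + b) 120 then a + b else 240 - a - b

/-- A reduced triple together with its trace, packed into one number. -/
def encodeTriple (a b : ℕ) : ℕ :=
  residueTrace a b (thirdExponent a b) * 16384 + (a * 128 + b)

/-- The encoded reduced triples not involving `-1`. -/
def encodedTriples : List ℕ :=
  (List.range 121).flatMap fun a =>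
    ((List.range 121).filter fun b => Nat.ble a b && Nat.ble b (thirdExponent a b) &&
      Nat.ble (thirdExponent a b) 119).map (encodeTriple a)

/-- The coincidences between traces of reduced triples, with `(a, b)` packed as `128 * a + b`. -/
def traceCoincidences : List (ℕ × ℕ) :=
  [(3900, 80), (6192, 1104), (6240, 7248), (3885, 1340), (2010, 6460), (4176, 1632), (2112, 4656),
    (2640, 1112), (2640, 6200), (1112, 6200)]

/-- Two encoded triples have different traces, or are equal, or are a listed coincidence. -/
def compatible (s t : ℕ) : Bool :=
  !Nat.beq (s / 16384) (t / 16384) || Nat.beq s t ||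
    traceCoincidences.any fun e =>
      (Nat.beq e.1 (s % 16384) && Nat.beq e.2 (t % 16384)) ||
        (Nat.beq e.1 (t % 16384) && Nat.beq e.2 (s % 16384))

/-- Pairwise compatibility, checked after sorting into buckets by the binary digits of the
trace. -/
def bucketCheck : ℕ → List ℕ → Bool
  | 0, L => L.all fun s => L.all fun t => compatible s t
  | n + 1, L =>
    match L with
    | [] => true
    | [_] => true
    | s :: t :: L =>
      bucketCheck n ((s :: t :: L).filter fun s => Nat.beq (s / 16384 / 2 ^ n % 2) 0) &&
        bucketCheck n ((s :: t :: L).filter fun s => !Nat.beq (s / 16384 / 2 ^ n % 2) 0)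

theorem compatible_self (s : ℕ) : compatible s s = true := by
  simp [compatible]

/-- Elements separated into different buckets differ in a binary digit of the trace, so they are
compatible without being compared. -/
theorem compatible_of_bucketCheck {n : ℕ} {L : List ℕ} (h : bucketCheck n L = true) :
    ∀ s ∈ L, ∀ t ∈ L, compatible s t = true := by
  induction n generalizing L with
  | zero =>
    intro s hs t ht
    simp only [bucketCheck, List.all_eq_true] at h
    exact h s hs t ht
  | succ n ih =>
    intro s hs t ht
    match L, h with
    | [], _ => simp at hs
    | [c], _ =>
      rw [List.mem_singleton] at hs ht
      rw [hs, ht]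
      exact compatible_self c
    | a :: b :: L, h =>
      rw [bucketCheck, Bool.and_eq_true] at h
      by_cases hst : Nat.beq (s / 16384 / 2 ^ n % 2) 0 = Nat.beq (t / 16384 / 2 ^ n % 2) 0
      · cases hc : Nat.beq (s / 16384 / 2 ^ n % 2) 0
        · exact ih h.2 s (List.mem_filter.mpr ⟨hs, by rw [hc]; rfl⟩) t
            (List.mem_filter.mpr ⟨ht, by rw [← hst, hc]; rfl⟩)
        · exact ih h.1 s (List.mem_filter.mpr ⟨hs, hc⟩) t
            (List.mem_filter.mpr ⟨ht, by rw [← hst, hc]⟩)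
      · have : Nat.beq (s / 16384) (t / 16384) = false := by
          rw [← Bool.not_eq_true, Nat.beq_eq]
          exact fun h => hst (by rw [h])
        rw [compatible, this]
        rfl

-- Bucketing on the low 14 binary digits of the trace avoids comparing all pairs of triples.
set_option maxRecDepth 100000 in
theorem bucketCheck_encodedTriples : bucketCheck 14 encodedTriples = true := by
  decide +kernel

-- `4194960` is `-1` in the prime field. The three codes are the reduced exponents `(20, 80)`, `(8,
-- 88)`, `(48, 56)`: type (ii) once and type (iii) twice in case (f).
set_option maxRecDepth 100000 in
theorem residueTrace_eq_neg_one_check : (encodedTriples.all fun s =>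
    !Nat.beq (s / 16384) 4194960 ||
      (Nat.beq (s % 16384) 2640 || Nat.beq (s % 16384) 1112 || Nat.beq (s % 16384) 6200)) = true := by
  decide +kernel

/-! ### Reduction of 240th roots of unity to the prime field. -/

section

theorem prime_4194961 : Nat.Prime 4194961 := by norm_num

/-- Since `4194961 = 240 * 17479 + 1` is prime, its field contains elements of order `240`; the
order is checked at the exponents `240 / q` for `q = 2, 3, 5`. -/
theorem isRoot_cyclotomic_residue :
    (Polynomial.cyclotomic 240 (ZMod 4194961)).IsRoot ((3524605 : ℕ) : ZMod 4194961) := by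
  have : Fact (Nat.Prime 4194961) := ⟨prime_4194961⟩
  have h : ∀ n : ℕ, (((3524605 : ℕ) : ZMod 4194961)) ^ n = 1 ↔ 3524605 ^ n % 4194961 = 1 := by
    intro n
    rw [← Nat.cast_pow, ← Nat.cast_one (R := ZMod 4194961), ZMod.natCast_eq_natCast_iff]
    rfl
  have ho : orderOf (((3524605 : ℕ) : ZMod 4194961)) = 240 := by
    apply orderOf_eq_of_pow_and_pow_div_prime (by norm_num)
    · rw [h]; norm_num
    · intro q hq hd
      have : q ∈ Nat.primeFactors 240 := Nat.mem_primeFactors.mpr ⟨hq, hd, by norm_num⟩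
      have h240 : Nat.primeFactors 240 = {2, 3, 5} := by
        rw [show 240 = 2 ^ 4 * (3 * 5) by norm_num,
          Nat.primeFactors_mul (by norm_num) (by norm_num),
          Nat.primeFactors_mul (by norm_num) (by norm_num),
          Nat.primeFactors_prime_pow (by norm_num) Nat.prime_two,
          Nat.Prime.primeFactors Nat.prime_three, Nat.Prime.primeFactors Nat.prime_five]
        rfl
      rw [h240] at this
      simp only [Finset.mem_insert, Finset.mem_singleton] at this
      rw [Ne, h]
      rcases this with rfl | rfl | rfl <;> norm_num
  exact (IsPrimitiveRoot.iff_orderOf.mpr ho).isRoot_cyclotomic (by norm_num)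

/-- The exponents of the triple with reduced exponents `a, b, c` modulo `240`. -/
def reducedExponents (a b c : ℕ) : Multiset ℕ := {a, b, c, 240 - a, 240 - b, 240 - c}

theorem residueTrace_cast (a b c : ℕ) :
    ((residueTrace a b c : ℕ) : ZMod 4194961) =
      ((reducedExponents a b c).map (((3524605 : ℕ) : ZMod 4194961) ^ ·)).sum := by
  rw [residueTrace, ZMod.natCast_mod]
  simp only [reducedExponents, Multiset.insert_eq_cons, Multiset.map_cons, Multiset.map_singleton,
    Multiset.sum_cons, Multiset.sum_singleton, Nat.cast_add, Nat.cast_pow]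
  ring

variable {A B : Multiset ℂ} {x y z u v w ζ : ℂ}

theorem IsPrimitiveRoot.inv_pow_eq (hζ : IsPrimitiveRoot ζ 240) {a : ℕ} (ha : a ≤ 240) :
    (ζ ^ a)⁻¹ = ζ ^ (240 - a) :=
  inv_eq_of_mul_eq_one_right (by rw [← pow_add, Nat.add_sub_cancel' ha, hζ.pow_eq_one])

theorem invMultiset_inv_left (x y z : ℂ) : invMultiset x⁻¹ y z = invMultiset x y z := by
  simp only [invMultiset, Multiset.insert_eq_cons, ← Multiset.singleton_add, inv_inv]
  abel

theorem IsPrimitiveRoot.exists_zpow_eq (hζ : IsPrimitiveRoot ζ 240) {x : ℂ} (hx : x ^ 240 = 1) :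
    ∃ a : ℕ, a ≤ 120 ∧ ∃ i : ℤ, (i = a ∨ i = -a) ∧ x = ζ ^ i := by
  obtain ⟨n, hn, rfl⟩ := hζ.eq_pow_of_pow_eq_one hx
  rcases Nat.lt_or_ge 120 n with h | h
  · refine ⟨240 - n, by omega, (n : ℤ) - 240, Or.inr (by omega), ?_⟩
    rw [zpow_sub₀ (hζ.ne_zero (by norm_num))]
    have : ζ ^ (240 : ℤ) = 1 := by exact_mod_cast hζ.pow_eq_one
    rw [this, div_one, zpow_natCast]
  · exact ⟨n, h, n, Or.inl rfl, by rw [zpow_natCast]⟩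

/-- Inverting a member does not change the multiset, so exponents may be taken in `[0, 120]` and
sorted. A signed sum divisible by `240` then means that the largest is the sum of the others, or
that all three add to `240`. -/
theorem IsTriple.exists_reduced (hζ : IsPrimitiveRoot ζ 240) (hA : IsTriple 240 A x y z) :
    ∃ a b : ℕ, a ≤ b ∧ b ≤ thirdExponent a b ∧ thirdExponent a b ≤ 120 ∧
      A = invMultiset (ζ ^ a) (ζ ^ b) (ζ ^ thirdExponent a b) := by
  obtain ⟨a, ha, i, hi, rfl⟩ := hζ.exists_zpow_eq hA.hx
  obtain ⟨b, hb, j, hj, rfl⟩ := hζ.exists_zpow_eq hA.hy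
  obtain ⟨c, hc, k, hk, rfl⟩ := hζ.exists_zpow_eq hA.hz
  have h0 : ζ ≠ 0 := hζ.ne_zero (by norm_num)
  have hd : (240 : ℤ) ∣ i + j + k := by
    have := hA.prod
    rw [← zpow_add₀ h0, ← zpow_add₀ h0] at this
    exact_mod_cast (hζ.zpow_eq_one_iff_dvd _).mp this
  have flip : ∀ {a : ℕ} {i : ℤ}, (i = a ∨ i = -a) → ∀ y z,
      invMultiset (ζ ^ i) y z = invMultiset (ζ ^ a) y z := by
    rintro a i (rfl | rfl) y z
    · rw [zpow_natCast]
    · rw [zpow_neg, zpow_natCast, invMultiset_inv_left]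
  have hAeq : A = invMultiset (ζ ^ a) (ζ ^ b) (ζ ^ c) := by
    rw [hA.eq, flip hi, invMultiset_rotate, flip hj, invMultiset_rotate, flip hk,
      invMultiset_rotate]
  have hrel : (c = a + b ∨ a = b + c ∨ b = a + c) ∨ a + b + c = 240 := by omega
  have main : ∀ {a b c : ℕ}, a ≤ b → b ≤ c → c ≤ 120 →
      ((c = a + b ∨ a = b + c ∨ b = a + c) ∨ a + b + c = 240) →
      c = thirdExponent a b := by
    intro a b c h1 h2 h3 h4
    rw [thirdExponent]
    cases h : Nat.ble (a + b) 120
    · have : ¬ (a + b ≤ 120) := by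
        rw [← Nat.ble_eq, h]; simp
      simp only [cond_false]
      omega
    · have : a + b ≤ 120 := by rwa [Nat.ble_eq] at h
      simp only [cond_true]
      omega
  have fin : ∀ {a b c : ℕ}, a ≤ b → b ≤ c → c ≤ 120 →
      ((c = a + b ∨ a = b + c ∨ b = a + c) ∨ a + b + c = 240) →
      A = invMultiset (ζ ^ a) (ζ ^ b) (ζ ^ c) →
      ∃ a b : ℕ, a ≤ b ∧ b ≤ thirdExponent a b ∧ thirdExponent a b ≤ 120 ∧
      A = invMultiset (ζ ^ a) (ζ ^ b) (ζ ^ thirdExponent a b) := by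
    intro a b c h1 h2 h3 h4 h5
    have h6 := main h1 h2 h3 h4
    exact ⟨a, b, h1, by rwa [← h6], by rwa [← h6], by rwa [← h6]⟩
  rcases le_total a b with h1 | h1 <;> rcases le_total b c with h2 | h2 <;>
    rcases le_total a c with h3 | h3
  · exact fin h1 h2 hc (by omega) hAeq
  · exact fin h1 h2 hc (by omega) hAeq
  · exact fin h3 h2 hb (by omega) (by rw [hAeq, invMultiset_rotate, invMultiset_swap,
      invMultiset_rotate, invMultiset_rotate, invMultiset_swap, invMultiset_rotate])
  · exact fin h3 h1 hb (by omega) (by rw [hAeq, invMultiset_rotate, invMultiset_rotate])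
  · exact fin h1 h3 hc (by omega) (by rw [hAeq, invMultiset_swap])
  · exact fin h2 h3 ha (by omega) (by rw [hAeq, invMultiset_rotate])
  · exact fin h2 h1 ha (by omega) (by rw [hAeq, invMultiset_swap, invMultiset_rotate,
      invMultiset_rotate])
  · exact fin h2 h1 ha (by omega) (by rw [hAeq, invMultiset_swap, invMultiset_rotate,
      invMultiset_rotate])

theorem invMultiset_pow_eq (hζ : IsPrimitiveRoot ζ 240) {a b c : ℕ} (ha : a ≤ 240) (hb : b ≤ 240)
    (hc : c ≤ 240) : invMultiset (ζ ^ a) (ζ ^ b) (ζ ^ c) = (reducedExponents a b c).map (ζ ^ ·) := by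
  simp [invMultiset, reducedExponents, hζ.inv_pow_eq ha, hζ.inv_pow_eq hb, hζ.inv_pow_eq hc]

/-- The multiset of powers of `ζ` given by the reduced exponents with code `128 * a + b`. -/
noncomputable def codeMultiset (ζ : ℂ) (n : ℕ) : Multiset ℂ :=
  (reducedExponents (n / 128) (n % 128) (thirdExponent (n / 128) (n % 128))).map (ζ ^ ·)

theorem IsTriple.exists_code (hζ : IsPrimitiveRoot ζ 240) (hA : IsTriple 240 A x y z)
    (hn : -1 ∉ A) : ∃ s ∈ encodedTriples, A = codeMultiset ζ (s % 16384) ∧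
      ((s / 16384 : ℕ) : ZMod 4194961) =
        ((reducedExponents (s % 16384 / 128) (s % 16384 % 128)
          (thirdExponent (s % 16384 / 128) (s % 16384 % 128))).map
            (((3524605 : ℕ) : ZMod 4194961) ^ ·)).sum ∧ s / 16384 < 4194961 := by
  obtain ⟨a, b, h1, h2, h3, h4⟩ := hA.exists_reduced hζ
  -- The largest exponent is `120` only if `-1` occurs; this matches the bound `119` in
  -- `encodedTriples`.
  have hne : thirdExponent a b ≠ 120 := by
    intro h
    apply hn
    rw [h4, mem_invMultiset, h]
    right; right; left
    have : IsPrimitiveRoot (ζ ^ 120) 2 := hζ.pow (by norm_num) (by norm_num)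
    exact this.eq_neg_one_of_two_right.symm
  have hmod : encodeTriple a b % 16384 = a * 128 + b := by
    rw [encodeTriple]; omega
  have hdiv : encodeTriple a b / 16384 = residueTrace a b (thirdExponent a b) := by
    rw [encodeTriple]; omega
  have e1 : (a * 128 + b) / 128 = a := by omega
  have e2 : (a * 128 + b) % 128 = b := by omega
  refine ⟨encodeTriple a b, ?_, ?_, ?_, ?_⟩
  · rw [encodedTriples, List.mem_flatMap]
    refine ⟨a, List.mem_range.mpr (by omega), List.mem_map.mpr ⟨b, ?_, rfl⟩⟩
    rw [List.mem_filter, List.mem_range]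
    refine ⟨by omega, ?_⟩
    simp only [Bool.and_eq_true, Nat.ble_eq]
    omega
  · rw [hmod, codeMultiset, e1, e2, h4, invMultiset_pow_eq hζ (by omega) (by omega) (by omega)]
  · rw [hmod, hdiv, e1, e2, residueTrace_cast]
  · rw [hdiv, residueTrace]
    exact Nat.mod_lt _ (by norm_num)

/-- Only one direction is needed: equal complex traces have equal residues, and all pairs with equal
residues are equal or listed. -/
theorem eq_or_coincidence (hζ : IsPrimitiveRoot ζ 240) (hA : IsTriple 240 A x y z)
    (hB : IsTriple 240 B u v w) (h : A.sum = B.sum) (hnA : -1 ∉ A) (hnB : -1 ∉ B) :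
    A = B ∨ ∃ e ∈ traceCoincidences,
      (A = codeMultiset ζ e.1 ∧ B = codeMultiset ζ e.2) ∨
        (B = codeMultiset ζ e.1 ∧ A = codeMultiset ζ e.2) := by
  obtain ⟨s, hs, hAs, hs1, hs2⟩ := hA.exists_code hζ hnA
  obtain ⟨t, ht, hBt, ht1, ht2⟩ := hB.exists_code hζ hnB
  have hc := compatible_of_bucketCheck bucketCheck_encodedTriples s hs t ht
  have heq : s / 16384 = t / 16384 := by
    rw [hAs, hBt, codeMultiset, codeMultiset] at h
    have := sum_map_pow_eq_of_isRoot_cyclotomic (by norm_num) hζ h isRoot_cyclotomic_residue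
    rw [← hs1, ← ht1, ZMod.natCast_eq_natCast_iff', Nat.mod_eq_of_lt hs2,
      Nat.mod_eq_of_lt ht2] at this
    exact this
  simp only [compatible, heq, Bool.or_eq_true, Bool.not_eq_true', List.any_eq_true,
    Bool.and_eq_true, Nat.beq_eq] at hc
  rcases hc with (hc | hc) | ⟨e, he, hc | hc⟩
  · rw [← Bool.not_eq_true, Nat.beq_eq] at hc
    exact absurd rfl hc
  · left
    rw [hAs, hBt, hc]
  · exact Or.inr ⟨e, he, Or.inl ⟨by rw [hAs, hc.1], by rw [hBt, hc.2]⟩⟩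
  · exact Or.inr ⟨e, he, Or.inr ⟨by rw [hBt, hc.1], by rw [hAs, hc.2]⟩⟩

theorem code_of_sum_eq_neg_one (hζ : IsPrimitiveRoot ζ 240) (hA : IsTriple 240 A x y z)
    (h : A.sum = -1) (hnA : -1 ∉ A) :
    A = codeMultiset ζ 2640 ∨ A = codeMultiset ζ 1112 ∨ A = codeMultiset ζ 6200 := by
  obtain ⟨s, hs, hAs, hs1, hs2⟩ := hA.exists_code hζ hnA
  have hc := List.all_eq_true.mp residueTrace_eq_neg_one_check s hs
  have h120 : ζ ^ 120 = -1 := by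
    have : IsPrimitiveRoot (ζ ^ 120) 2 := hζ.pow (by norm_num) (by norm_num)
    exact this.eq_neg_one_of_two_right
  have heq : s / 16384 = 4194960 := by
    have h' : A.sum = (Multiset.map (ζ ^ ·) {120}).sum := by simpa [h120] using h
    rw [hAs, codeMultiset] at h'
    have := sum_map_pow_eq_of_isRoot_cyclotomic (by norm_num) hζ h' isRoot_cyclotomic_residue
    rw [← hs1, Multiset.map_singleton, Multiset.sum_singleton, ← Nat.cast_pow,
      ZMod.natCast_eq_natCast_iff', Nat.mod_eq_of_lt hs2] at this
    rw [this]
    norm_num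
  simp only [heq, Bool.or_eq_true, Bool.not_eq_true', Nat.beq_eq] at hc
  rcases hc with hc | (hc | hc) | hc
  · rw [← Bool.not_eq_true, Nat.beq_eq] at hc
    exact absurd rfl hc
  · exact Or.inl (by rw [hAs, hc])
  · exact Or.inr (Or.inl (by rw [hAs, hc]))
  · exact Or.inr (Or.inr (by rw [hAs, hc]))

end

/-! ### Identification of the coincidences with the exceptional families. -/

section

variable {A B : Multiset ℂ} {x y z u v w ζ : ℂ}

theorem map_pow_congr (hζ : IsPrimitiveRoot ζ 240) {E F : Multiset ℕ}
    (h : E.map (· % 240) = F.map (· % 240)) : E.map (ζ ^ ·) = F.map (ζ ^ ·) := by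
  have key : ∀ E : Multiset ℕ, E.map (ζ ^ ·) = (E.map (· % 240)).map (ζ ^ ·) := by
    intro E
    rw [Multiset.map_map]
    refine Multiset.map_congr rfl fun n _ => ?_
    have := pow_mod_orderOf ζ n
    rw [← hζ.eq_orderOf] at this
    exact this.symm
  rw [key E, key F, h]

/-- In its applications `F` lists the exponents, unreduced, obtained from a target multiset by
writing `-1` as `ζ ^ 120` and `conj ζ` as `ζ ^ 239`. -/
theorem codeMultiset_eq (hζ : IsPrimitiveRoot ζ 240) {n : ℕ} {F : Multiset ℕ}
    (h : (reducedExponents (n / 128) (n % 128) (thirdExponent (n / 128) (n % 128))).map (· % 240)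
      = F.map (· % 240)) : codeMultiset ζ n = F.map (ζ ^ ·) :=
  map_pow_congr hζ h

theorem IsPrimitiveRoot.pow_gcd (hζ : IsPrimitiveRoot ζ 240) {k n : ℕ} (hk : k ≠ 0)
    (h : 240 / Nat.gcd 240 k = n) : IsPrimitiveRoot (ζ ^ k) n := by
  rw [IsPrimitiveRoot.iff_orderOf, orderOf_pow' ζ hk, ← hζ.eq_orderOf, h]

theorem IsPrimitiveRoot.conj_eq_pow (hζ : IsPrimitiveRoot ζ 240) : conj ζ = ζ ^ 239 := by
  rw [← Complex.inv_eq_conj (hζ.norm'_eq_one (by norm_num))]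
  exact inv_eq_of_mul_eq_one_right (by rw [← pow_succ', hζ.pow_eq_one])

theorem IsPrimitiveRoot.neg_eq_pow_mul (hζ : IsPrimitiveRoot ζ 240) (t : ℂ) :
    -t = ζ ^ 120 * t := by
  have : IsPrimitiveRoot (ζ ^ 120) 2 := hζ.pow (by norm_num) (by norm_num)
  rw [this.eq_neg_one_of_two_right, neg_one_mul]

theorem codeMultiset_fourThree (hζ : IsPrimitiveRoot ζ 240) :
    codeMultiset ζ 2640 = fourThreeMultiset (ζ ^ 60) (ζ ^ 80) := by
  rw [codeMultiset_eq hζ (F := {140, 260, 80, 340, 220, 160}) (by decide), fourThreeMultiset]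
  simp only [hζ.neg_eq_pow_mul, ← pow_mul, ← pow_add, Nat.reduceMul,
    Nat.reduceAdd, Multiset.insert_eq_cons, Multiset.map_cons, Multiset.map_singleton]

theorem codeMultiset_threeFive (hζ : IsPrimitiveRoot ζ 240) :
    codeMultiset ζ 1112 = threeFiveMultiset (ζ ^ 80) (ζ ^ 48) := by
  rw [codeMultiset_eq hζ (F := {248, 328, 22944, 11752, 11672, 96}) (by decide), threeFiveMultiset]
  simp only [hζ.neg_eq_pow_mul, map_pow, hζ.conj_eq_pow, ← pow_mul, ← pow_add, Nat.reduceMul,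
    Nat.reduceAdd, Multiset.insert_eq_cons, Multiset.map_cons, Multiset.map_singleton]

theorem codeMultiset_threeFive' (hζ : IsPrimitiveRoot ζ 240) :
    codeMultiset ζ 6200 = threeFiveMultiset (ζ ^ 80) (ζ ^ 96) := by
  rw [codeMultiset_eq hζ (F := {296, 376, 45888, 23224, 23144, 192}) (by decide), threeFiveMultiset]
  simp only [hζ.neg_eq_pow_mul, map_pow, hζ.conj_eq_pow, ← pow_mul, ← pow_add, Nat.reduceMul,
    Nat.reduceAdd, Multiset.insert_eq_cons, Multiset.map_cons, Multiset.map_singleton]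

theorem exceptionalPair_of_coincidence (hζ : IsPrimitiveRoot ζ 240) {e : ℕ × ℕ}
    (he : e ∈ traceCoincidences) :
    ExceptionalPair (codeMultiset ζ e.1) (codeMultiset ζ e.2) := by
  have hω : IsPrimitiveRoot (ζ ^ 80) 3 := hζ.pow_gcd (by norm_num) (by norm_num)
  have hι : IsPrimitiveRoot (ζ ^ 60) 4 := hζ.pow_gcd (by norm_num) (by norm_num)
  have hφ : IsPrimitiveRoot (ζ ^ 48) 5 := hζ.pow_gcd (by norm_num) (by norm_num)
  have hφ' : IsPrimitiveRoot (ζ ^ 96) 5 := hζ.pow_gcd (by norm_num) (by norm_num)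
  -- Case (f) asks for a root of order `7` even when neither multiset involves it.
  have hσ := Complex.isPrimitiveRoot_exp 7 (by norm_num)
  simp only [traceCoincidences, List.mem_cons, List.not_mem_nil, or_false] at he
  rcases he with rfl | rfl | rfl | rfl | rfl | rfl | rfl | rfl | rfl | rfl
  · left
    refine ⟨ζ ^ 30, ζ ^ 80, hζ.pow_gcd (by norm_num) (by norm_num), hω, ?_, ?_⟩
    · rw [codeMultiset_eq hζ (F := {30, 150, 14460, 7170, 7290, 180}) (by decide)]
      simp only [hζ.neg_eq_pow_mul, map_pow, hζ.conj_eq_pow, ← pow_mul, ← pow_add, Nat.reduceMul,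
        Nat.reduceAdd, Multiset.insert_eq_cons, Multiset.map_cons, Multiset.map_singleton]
    · rw [codeMultiset_eq hζ (F := {80, 160, 0, 160, 80, 0}) (by decide)]
      simp only [← pow_mul, Nat.reduceMul, Multiset.insert_eq_cons, Multiset.map_cons,
        Multiset.map_singleton, pow_zero]
  · right; left
    refine ⟨ζ ^ 96, ζ ^ 80, hφ', hω, ?_, ?_⟩
    · rw [codeMultiset_eq hζ (F := {96, 192, 68832, 22944, 45888, 288}) (by decide)]
      simp only [map_pow, hζ.conj_eq_pow, ← pow_mul, Nat.reduceMul,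
        Multiset.insert_eq_cons, Multiset.map_cons, Multiset.map_singleton]
    · rw [codeMultiset_eq hζ (F := {80, 392, 46088, 160, 46168, 472}) (by decide)]
      simp only [hζ.neg_eq_pow_mul, map_pow, hζ.conj_eq_pow, ← pow_mul, ← pow_add, Nat.reduceMul,
        Nat.reduceAdd, Multiset.insert_eq_cons, Multiset.map_cons, Multiset.map_singleton]
  · right; left
    refine ⟨ζ ^ 48, ζ ^ 80, hφ, hω, ?_, ?_⟩
    · rw [codeMultiset_eq hζ (F := {48, 96, 34416, 11472, 22944, 144}) (by decide)]
      simp only [map_pow, hζ.conj_eq_pow, ← pow_mul, Nat.reduceMul,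
        Multiset.insert_eq_cons, Multiset.map_cons, Multiset.map_singleton]
    · rw [codeMultiset_eq hζ (F := {80, 296, 23144, 160, 23224, 376}) (by decide)]
      simp only [hζ.neg_eq_pow_mul, map_pow, hζ.conj_eq_pow, ← pow_mul, ← pow_add, Nat.reduceMul,
        Nat.reduceAdd, Multiset.insert_eq_cons, Multiset.map_cons, Multiset.map_singleton]
  · right; right; right; left
    refine ⟨ζ ^ 45, ζ ^ 80, hζ.pow_gcd (by norm_num) (by norm_num), hω, ?_, ?_⟩
    · rw [codeMultiset_eq hζ (F := {45, 165, 21630, 10755, 10875, 210}) (by decide)]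
      simp only [hζ.neg_eq_pow_mul, map_pow, hζ.conj_eq_pow, ← pow_mul, ← pow_add, Nat.reduceMul,
        Nat.reduceAdd, Multiset.insert_eq_cons, Multiset.map_cons, Multiset.map_singleton]
    · rw [codeMultiset_eq hζ (F := {170, 250, 43020, 21670, 21590, 180}) (by decide)]
      simp only [map_pow, hζ.conj_eq_pow, ← pow_mul, ← pow_add, Nat.reduceMul,
        Nat.reduceAdd, Multiset.insert_eq_cons, Multiset.map_cons, Multiset.map_singleton]
  · right; right; right; left
    refine ⟨ζ ^ 15, ζ ^ 80, hζ.pow_gcd (by norm_num) (by norm_num), hω, ?_, ?_⟩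
    · rw [codeMultiset_eq hζ (F := {15, 135, 7290, 3585, 3705, 150}) (by decide)]
      simp only [hζ.neg_eq_pow_mul, map_pow, hζ.conj_eq_pow, ← pow_mul, ← pow_add, Nat.reduceMul,
        Nat.reduceAdd, Multiset.insert_eq_cons, Multiset.map_cons, Multiset.map_singleton]
    · rw [codeMultiset_eq hζ (F := {110, 190, 14340, 7330, 7250, 60}) (by decide)]
      simp only [map_pow, hζ.conj_eq_pow, ← pow_mul, ← pow_add, Nat.reduceMul,
        Nat.reduceAdd, Multiset.insert_eq_cons, Multiset.map_cons, Multiset.map_singleton]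
  · right; right; right; right; left
    refine ⟨ζ ^ 96, ζ ^ 80, ζ ^ 60, hφ', hω, hι, ?_, ?_⟩
    · rw [codeMultiset_eq hζ (F := {80, 272, 45968, 160, 46048, 352}) (by decide)]
      simp only [map_pow, hζ.conj_eq_pow, ← pow_mul, ← pow_add, Nat.reduceMul,
        Nat.reduceAdd, Multiset.insert_eq_cons, Multiset.map_cons, Multiset.map_singleton]
    · rw [codeMultiset_eq hζ (F := {96, 252, 69012, 22944, 46068, 348}) (by decide)]
      simp only [hζ.neg_eq_pow_mul, map_pow, hζ.conj_eq_pow, ← pow_mul, ← pow_add, Nat.reduceMul,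
        Nat.reduceAdd, Multiset.insert_eq_cons, Multiset.map_cons, Multiset.map_singleton]
  · right; right; right; right; left
    refine ⟨ζ ^ 48, ζ ^ 80, ζ ^ 60, hφ, hω, hι, ?_, ?_⟩
    · rw [codeMultiset_eq hζ (F := {80, 176, 23024, 160, 23104, 256}) (by decide)]
      simp only [map_pow, hζ.conj_eq_pow, ← pow_mul, ← pow_add, Nat.reduceMul,
        Nat.reduceAdd, Multiset.insert_eq_cons, Multiset.map_cons, Multiset.map_singleton]
    · rw [codeMultiset_eq hζ (F := {48, 156, 34596, 11472, 23124, 204}) (by decide)]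
      simp only [hζ.neg_eq_pow_mul, map_pow, hζ.conj_eq_pow, ← pow_mul, ← pow_add, Nat.reduceMul,
        Nat.reduceAdd, Multiset.insert_eq_cons, Multiset.map_cons, Multiset.map_singleton]
  all_goals right; right; right; right; right
  · exact ⟨_, _, _, _, hω, hι, hφ, hσ, Or.inl ⟨Or.inr (Or.inl (codeMultiset_fourThree hζ)),
      Or.inr (Or.inr (codeMultiset_threeFive hζ))⟩⟩
  · exact ⟨_, _, _, _, hω, hι, hφ', hσ, Or.inl ⟨Or.inr (Or.inl (codeMultiset_fourThree hζ)),
      Or.inr (Or.inr (codeMultiset_threeFive' hζ))⟩⟩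
  · refine ⟨_, _, _, _, hω, hι, hφ, hσ, Or.inr ⟨_, hφ', ?_, codeMultiset_threeFive hζ,
      codeMultiset_threeFive' hζ⟩⟩
    intro h
    have := hζ.pow_inj (by norm_num) (by norm_num) h
    norm_num at this

theorem exceptional_of_pow_240 (hA : IsTriple 240 A x y z) (hB : IsTriple 240 B u v w)
    (h : A.sum = B.sum) (hnA : -1 ∉ A) (hnB : -1 ∉ B) :
    A = B ∨ ExceptionalPair A B ∨ ExceptionalPair B A := by
  have hζ := Complex.isPrimitiveRoot_exp 240 (by norm_num)
  rcases eq_or_coincidence hζ hA hB h hnA hnB with h | ⟨e, he, ⟨rfl, rfl⟩ | ⟨rfl, rfl⟩⟩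
  · exact Or.inl h
  · exact Or.inr (Or.inl (exceptionalPair_of_coincidence hζ he))
  · exact Or.inr (Or.inr (exceptionalPair_of_coincidence hζ he))

theorem conj_eq_inv_of_pow_eq_one {t : ℂ} {n : ℕ} (hn : n ≠ 0) (h : t ^ n = 1) :
    conj t = t⁻¹ :=
  (Complex.inv_eq_conj (Complex.norm_eq_one_of_pow_eq_one h hn)).symm

theorem sevenMultiset_eq {σ : ℂ} (hσ : IsPrimitiveRoot σ 7) :
    invMultiset σ (σ ^ 2) (σ ^ 4) = sevenMultiset σ := by
  have h7 := hσ.pow_eq_one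
  have h4 : σ⁻¹ ^ 3 = σ ^ 4 := by
    rw [inv_pow]
    exact inv_eq_of_mul_eq_one_right (by rw [← pow_add, h7])
  have h3 : (σ ^ 4)⁻¹ = σ ^ 3 := inv_eq_of_mul_eq_one_right (by rw [← pow_add, h7])
  rw [invMultiset, sevenMultiset, conj_eq_inv_of_pow_eq_one (by norm_num) h7, h4, h3, inv_pow]

theorem exceptional_of_seven {N : ℕ} (hA : IsTriple N A x y z) (hN : N ∣ 240) (hs : A.sum = -1)
    (hn : -1 ∉ A) {σ : ℂ} (hσ : IsPrimitiveRoot σ 7) (hB : B = invMultiset σ (σ ^ 2) (σ ^ 4)) :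
    ExceptionalPair A B := by
  have hζ := Complex.isPrimitiveRoot_exp 240 (by norm_num)
  have hA' : IsTriple 240 A x y z := hA.restrict fun t ht => by
    obtain ⟨m, hm⟩ := hN
    rw [hm, pow_mul, hA.pow_eq_one t ht, one_pow]
  rw [sevenMultiset_eq hσ] at hB
  have hω := hζ.pow_gcd (k := 80) (n := 3) (by norm_num) (by norm_num)
  have hι := hζ.pow_gcd (k := 60) (n := 4) (by norm_num) (by norm_num)
  have hφ := hζ.pow_gcd (k := 48) (n := 5) (by norm_num) (by norm_num)
  have hφ' := hζ.pow_gcd (k := 96) (n := 5) (by norm_num) (by norm_num)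
  right; right; right; right; right
  rcases code_of_sum_eq_neg_one hζ hA' hs hn with h | h | h
  · exact ⟨_, _, _, _, hω, hι, hφ, hσ, Or.inl
      ⟨Or.inr (Or.inl (h.trans (codeMultiset_fourThree hζ))), Or.inl hB⟩⟩
  · exact ⟨_, _, _, _, hω, hι, hφ, hσ, Or.inl
      ⟨Or.inr (Or.inr (h.trans (codeMultiset_threeFive hζ))), Or.inl hB⟩⟩
  · exact ⟨_, _, _, _, hω, hι, hφ', hσ, Or.inl
      ⟨Or.inr (Or.inr (h.trans (codeMultiset_threeFive' hζ))), Or.inl hB⟩⟩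

theorem exceptional_of_seven_three {σ ω : ℂ} (hσ : IsPrimitiveRoot σ 7) (hω : IsPrimitiveRoot ω 3)
    (hA : A = invMultiset ω (σ ^ 3 * ω) ((σ ^ 3)⁻¹ * ω))
    (hB : B = invMultiset (-(σ * ω)) (-(σ * ω ^ 2)) (σ⁻¹ ^ 2)) : ExceptionalPair A B := by
  have h3 := hω.pow_eq_one
  have hi : ω⁻¹ = ω ^ 2 := inv_eq_of_mul_eq_one_right (by rw [← pow_succ', h3])
  have hi2 : (ω ^ 2)⁻¹ = ω := by rw [← hi, inv_inv]
  right; right; left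
  refine ⟨σ, ω, hσ, hω, ?_, ?_⟩
  · rw [hA, conj_eq_inv_of_pow_eq_one (by norm_num) hσ.pow_eq_one, invMultiset]
    simp only [mul_inv, inv_inv, hi, inv_pow]
  · rw [hB, conj_eq_inv_of_pow_eq_one (by norm_num) hσ.pow_eq_one, invMultiset]
    simp only [mul_inv, inv_inv, hi, hi2, inv_pow, inv_neg]

/-! ### Induction on the common order and the final assembly. -/

theorem dvd_1680_of_prime_pow {N : ℕ} (hN : 0 < N) (h : ∀ p, p.Prime → p ∣ N → p ≤ 9)
    (h2 : ¬ 32 ∣ N) (h3 : ¬ 9 ∣ N) (h5 : ¬ 25 ∣ N) (h7 : ¬ 49 ∣ N) : N ∣ 1680 := by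
  rw [← Nat.factorization_prime_le_iff_dvd hN.ne' (by norm_num)]
  intro p hp
  by_cases hpN : p ∣ N
  · have bound : ∀ {k}, ¬ p ^ (k + 1) ∣ N → p ^ k ∣ 1680 →
        N.factorization p ≤ Nat.factorization 1680 p := by
      intro k h1 h2
      have h3 := (hp.pow_dvd_iff_le_factorization (by norm_num)).mp h2
      have h4 := (hp.pow_dvd_iff_le_factorization hN.ne').not.mp h1
      omega
    have := h p hp hpN
    interval_cases p
    · exact absurd hp (by norm_num)
    · exact absurd hp (by norm_num)
    · exact bound (k := 4) h2 (by norm_num)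
    · exact bound (k := 1) h3 (by norm_num)
    · exact absurd hp (by norm_num)
    · exact bound (k := 1) h5 (by norm_num)
    · exact absurd hp (by norm_num)
    · exact bound (k := 1) h7 (by norm_num)
    · exact absurd hp (by norm_num)
    · exact absurd hp (by norm_num)
  · rw [Nat.factorization_eq_zero_of_not_dvd hpN]
    exact Nat.zero_le _

theorem eq_or_exceptional {N : ℕ} (hN : 0 < N) (hA : IsTriple N A x y z) (hB : IsTriple N B u v w)
    (h : A.sum = B.sum) (hnA : -1 ∉ A) (hnB : -1 ∉ B) :
    A = B ∨ ExceptionalPair A B ∨ ExceptionalPair B A := by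
  by_cases hd : ∀ t ∈ A, t ∉ B
  swap
  · push Not at hd
    obtain ⟨t, htA, htB⟩ := hd
    exact Or.inl (hA.eq_of_common hB h hnA htA htB)
  induction N using Nat.strong_induction_on with
  | _ N ih =>
  have descend : ∀ {p M : ℕ}, p.Prime → N = p * M →
      ((∀ t ∈ A, t ^ M = 1) ∧ ∀ t ∈ B, t ^ M = 1) →
      A = B ∨ ExceptionalPair A B ∨ ExceptionalPair B A := by
    intro p M hp hM h1
    have hM0 : 0 < M := Nat.pos_of_ne_zero (by rintro rfl; omega)
    refine ih M ?_ hM0 (hA.restrict h1.1) (hB.restrict h1.2)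
    rw [hM]
    exact (Nat.lt_mul_iff_one_lt_left hM0).mpr hp.one_lt
  have cls : ∀ {p M : ℕ}, p.Prime → N = p * M → 0 < M →
      (ClassDisjoint p M A B) ∨ (¬ p ∣ M ∧ ∃ C s, ClassShift p M s C A B) := by
    intro p M hp hM hM0
    obtain ⟨C, s, h1, h2, h3⟩ := exists_classSum_sub_eq hp hM0 (hM ▸ hA.pow_eq_one)
      (hM ▸ hB.pow_eq_one) h
    by_cases hC : C = 0
    · refine Or.inl ⟨fun ε hε => ?_, hnA, hnB, hd⟩
      have := h3 ε hε
      rw [hC, zero_mul] at this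
      exact sub_eq_zero.mp this
    · have h4 : ¬ p ∣ M := fun h => hC (h1 h)
      exact Or.inr ⟨h4, C, s, h3, hC, h2.resolve_left h4⟩
  have pos : ∀ {p M : ℕ}, N = p * M → 0 < M := fun hM => Nat.pos_of_ne_zero (by rintro rfl; omega)
  -- Once these descents no longer apply, `N` divides `1680 = 2⁴ * 3 * 5 * 7`.
  by_cases h32 : 32 ∣ N
  · obtain ⟨m, hm⟩ := h32
    have hM : N = 2 * (16 * m) := by omega
    have hM0 := pos hM
    rcases cls Nat.prime_two hM hM0 with hc | ⟨hc, -⟩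
    · exact descend Nat.prime_two hM (hc.pow_eq_one_of_two hM0 ⟨m, rfl⟩ h (hM ▸ hA) (hM ▸ hB))
    · exact absurd ⟨8 * m, by ring⟩ hc
  by_cases h9 : 9 ∣ N
  · obtain ⟨m, hm⟩ := h9
    have hM : N = 3 * (3 * m) := by omega
    have hM0 := pos hM
    rcases cls Nat.prime_three hM hM0 with hc | ⟨hc, -⟩
    · exact descend Nat.prime_three hM (hc.pow_eq_one_of_three hM0 ⟨m, rfl⟩ (hM ▸ hA) (hM ▸ hB))
    · exact absurd ⟨m, rfl⟩ hc
  by_cases h25 : 25 ∣ N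
  · obtain ⟨m, hm⟩ := h25
    have hM : N = 5 * (5 * m) := by omega
    rcases cls Nat.prime_five hM (pos hM) with hc | ⟨hc, -⟩
    · exact descend Nat.prime_five hM (hc.pow_eq_one_of_five_le Nat.prime_five le_rfl
        (Or.inr ⟨m, rfl⟩) (hM ▸ hA) (hM ▸ hB))
    · exact absurd ⟨m, rfl⟩ hc
  by_cases hbig : ∃ p, p.Prime ∧ p ∣ N ∧ 9 < p
  · obtain ⟨p, hp, ⟨M, hM⟩, hp9⟩ := hbig
    rcases cls hp hM (pos hM) with hc | ⟨-, C, s, hc⟩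
    · exact descend hp hM (hc.pow_eq_one_of_five_le hp (by omega) (Or.inl (by omega))
        (hM ▸ hA) (hM ▸ hB))
    · exact absurd (hc.le_nine hp (hM ▸ hA) (hM ▸ hB)) (by omega)
  have h7p : Nat.Prime 7 := by norm_num
  by_cases h7 : 7 ∣ N
  · obtain ⟨M, hM⟩ := h7
    rcases cls h7p hM (pos hM) with hc | ⟨h7M, C, s, hc⟩
    · exact descend h7p hM (hc.pow_eq_one_of_five_le h7p (by norm_num) (Or.inl (by norm_num))
        (hM ▸ hA) (hM ▸ hB))
    · have hdvd : N ∣ 1680 := by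
        refine dvd_1680_of_prime_pow hN (fun p hp hpN => ?_) h32 h9 h25 ?_
        · by_contra! h'
          exact hbig ⟨p, hp, hpN, h'⟩
        · intro h49
          exact h7M (by omega)
      have hM240 : M ∣ 240 := by
        rw [hM, show 1680 = 7 * 240 by norm_num] at hdvd
        exact Nat.dvd_of_mul_dvd_mul_left (by norm_num) hdvd
      -- The trivial class is occupied by `A` or `B`; this decides the order of the exceptional
      -- pair.
      rcases hc.cover (by norm_num) (one_pow _) with h1 | h1
      · right; left
        rcases hc.seven (hM ▸ hA) (hM ▸ hB) h1 with ⟨h2, h3, σ, hσ, h4⟩ | ⟨σ, ω, hσ, hω, h3, h4⟩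
        · exact exceptional_of_seven (hA.restrict h2) hM240 h3 hnA hσ h4
        · exact exceptional_of_seven_three hσ hω h3 h4
      · right; right
        rcases hc.symm.seven (hM ▸ hB) (hM ▸ hA) h1 with
          ⟨h2, h3, σ, hσ, h4⟩ | ⟨σ, ω, hσ, hω, h3, h4⟩
        · exact exceptional_of_seven (hB.restrict h2) hM240 h3 hnB hσ h4
        · exact exceptional_of_seven_three hσ hω h3 h4
  · have hdvd : N ∣ 1680 := by
      refine dvd_1680_of_prime_pow hN (fun p hp hpN => ?_) h32 h9 h25 (fun h49 => h7 (by omega))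
      by_contra! h'
      exact hbig ⟨p, hp, hpN, h'⟩
    obtain ⟨m, hm⟩ : N ∣ 240 := by
      refine (Nat.Coprime.dvd_mul_left ?_).mp (show N ∣ 7 * 240 from hdvd)
      rwa [Nat.coprime_comm, h7p.coprime_iff_not_dvd]
    refine exceptional_of_pow_240 (hA.restrict fun t ht => ?_) (hB.restrict fun t ht => ?_) h hnA hnB
    · rw [hm, pow_mul, hA.pow_eq_one t ht, one_pow]
    · rw [hm, pow_mul, hB.pow_eq_one t ht, one_pow]

theorem IsTriple.eq_negOneMultiset {N : ℕ} (hN : 0 < N) (hA : IsTriple N A x y z) (h : -1 ∈ A) :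
    ∃ a, IsOfFinOrder a ∧ A = negOneMultiset a := by
  obtain ⟨y, z, hA⟩ := hA.exists_of_mem h
  have hy := hA.y_ne_zero
  have hz : z = -y⁻¹ := by
    have := hA.prod
    field_simp
    linear_combination -this
  refine ⟨y, isOfFinOrder_iff_pow_eq_one.mpr ⟨N, hN, hA.hy⟩, ?_⟩
  rw [hA.eq, hz, negOneMultiset, conj_eq_inv_of_pow_eq_one hN.ne' hA.hy, invMultiset]
  simp only [inv_neg, inv_inv, inv_one, Multiset.insert_eq_cons, ← Multiset.singleton_add]
  abel

theorem exists_pow_eq_one_of_isOfFinOrder {γ : Fin 3 → ℂ} (h : ∀ i, IsOfFinOrder (γ i)) :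
    ∃ N, 0 < N ∧ ∀ i, γ i ^ N = 1 := by
  refine ⟨∏ i, orderOf (γ i), Finset.prod_pos fun i _ => (h i).orderOf_pos, fun i => ?_⟩
  exact orderOf_dvd_iff_pow_eq_one.mp (Finset.dvd_prod_of_mem _ (Finset.mem_univ i))

theorem isTriple_conjMultiset {γ : Fin 3 → ℂ} {N : ℕ} (hN : 0 < N) (h : ∀ i, γ i ^ N = 1)
    (hprod : ∏ i, γ i = 1) : IsTriple N (conjMultiset γ) (γ 0) (γ 1) (γ 2) := by
  refine ⟨h 0, h 1, h 2, by rw [← hprod, Fin.prod_univ_three], ?_⟩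
  simp only [conjMultiset, invMultiset, conj_eq_inv_of_pow_eq_one hN.ne' (h _)]

theorem sum_conjMultiset (γ : Fin 3 → ℂ) :
    (conjMultiset γ).sum = ∑ i, (γ i + conj (γ i)) := by
  simp only [conjMultiset, Multiset.insert_eq_cons, Multiset.sum_cons, Multiset.sum_singleton,
    Fin.sum_univ_three]
  ring

end

theorem mainTheorem11 (α β : Fin 3 → ℂ)
    (hα : ∀ i, IsOfFinOrder (α i)) (hβ : ∀ i, IsOfFinOrder (β i))
    (hαprod : ∏ i, α i = 1) (hβprod : ∏ i, β i = 1)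
    (hsum : ∑ i, (α i + conj (α i)) = ∑ i, (β i + conj (β i))) :
    conjMultiset α = conjMultiset β ∨
    (∃ a b : ℂ, IsOfFinOrder a ∧ IsOfFinOrder b ∧
      conjMultiset α = negOneMultiset a ∧ conjMultiset β = negOneMultiset b) ∨
    ExceptionalPair (conjMultiset α) (conjMultiset β) ∨
    ExceptionalPair (conjMultiset β) (conjMultiset α) := by
  obtain ⟨N₁, hN₁, h₁⟩ := exists_pow_eq_one_of_isOfFinOrder hα
  obtain ⟨N₂, hN₂, h₂⟩ := exists_pow_eq_one_of_isOfFinOrder hβ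
  have hN : 0 < N₁ * N₂ := Nat.mul_pos hN₁ hN₂
  have hA := isTriple_conjMultiset hN (fun i => by rw [pow_mul, h₁, one_pow]) hαprod
  have hB := isTriple_conjMultiset hN (fun i => by rw [mul_comm, pow_mul, h₂, one_pow]) hβprod
  rw [← sum_conjMultiset, ← sum_conjMultiset] at hsum
  by_cases hn : -1 ∈ conjMultiset α
  · have hn' : -1 ∈ conjMultiset β := by
      rw [hB.neg_one_mem_iff, ← hsum, ← hA.neg_one_mem_iff]
      exact hn
    obtain ⟨a, ha, hAa⟩ := hA.eq_negOneMultiset hN hn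
    obtain ⟨b, hb, hBb⟩ := hB.eq_negOneMultiset hN hn'
    exact Or.inr (Or.inl ⟨a, b, ha, hb, hAa, hBb⟩)
  · have hn' : -1 ∉ conjMultiset β := by
      rwa [hB.neg_one_mem_iff, ← hsum, ← hA.neg_one_mem_iff]
    rcases eq_or_exceptional hN hA hB hsum hn hn' with h | h
    · exact Or.inl h
    · exact Or.inr (Or.inr h)
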